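/- Let $\mathbb K$ be a field, $n\ge 1$ an integer, $m_1,\dots,m_n$ integers, and $\mathbf k_n=\bigoplus_{i=1}^n\mathbb K e_i$. Products and compositions are read from right to left, gradings are cohomological. **The internal DG-category $\mathscr I_n$.** It has objects $X_1,\dots,X_n$ and morphisms freely generated by $c^p_{ij}\in\hom(X_i,X_j)$, where $1\le i,j\le n$ and either $p\ge 1$, or $p=0$ and $i<j$. The degrees are $|c^p_{ij}|=1-2p+m_j-m_i$, and with $c^0_{ij}=0$ for $i\ge j$ and $\delta_{ij}=e_i$ if $i=j$, $\delta_{ij}=0$ otherwise, $$\partial c^p_{ij}=\delta_{p,1}\,\delta_{ij}+\sum_{0\le q\le p}\ \sum_{r=1}^n(-1)^{m_r+m_j}\,c^{p-q}_{rj}\,c^q_{ir},\qquad \partial(a_2a_1)=\partial(a_2)a_1+(-1)^{|a_2|}a_2\,\partial(a_1).$$ **$A_\infty$-conventions.** In an $A_\infty$-category, $\mathfrak m_d$ has degree $2-d$ and $\sum(-1)^{|a_1|+\dots+|a_j|-j}\mathfrak m_{d-i+1}(a_d,\dots,\mathfrak m_i(a_{j+i},\dots,a_{j+1}),a_j,\dots,a_1)=0$.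 Strict unitality means $\mathfrak m_2(a,e)=a$, $\mathfrak m_2(e,a)=(-1)^{|a|}a$, and all other operations with a unit among the inputs vanish. A DG-category is an $A_\infty$-category with $\mathfrak m_1(a)=(-1)^{|a|}\partial a$, $\mathfrak m_2(a_2,a_1)=(-1)^{|a_1|}a_2a_1$. **Kontsevich's category $\mathscr K_n$.** It is the strictly unital $A_\infty$-category with objects $Z_1,\dots,Z_n$ (indices in $\mathbb Z/n$), whose morphisms have as basis the units $e_i\in\hom(Z_i,Z_i)$ and elements $x_i\in\hom(Z_i,Z_{i+1})$, of degrees $|x_i|=1+m_{i+1}-m_i$ for $1\le i\le n-1$ and $|x_n|=-1+m_1-m_n$. The only non-zero operations on strings of the $x_i$ are $$\mathfrak m_n(x_{i-1},\dots,x_{i+1},x_i)=e_i,\qquad i\in\mathbb Z/n .$$ **Bar and cobar constructions.** Let $\mathscr A$ be a strictly unital $A_\infty$-category with the same index set of objects, whose morphisms split as $\mathbf k_n\oplus\bar{\mathscr A}$ (for $\mathscr K_n$, $\bar{\mathscr A}$ is spanned by the $x_i$). Write $\mathfrak m=\bar{\mathfrak m}+h$ for the components of the operations in $\bar{\mathscr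 A}$ and in $\mathbf k_n$. Then $\mathrm B\mathscr A=\mathbf k_n\oplus\bar C$ is the tensor coalgebra over $\mathbf k_n$ on $\bar{\mathscr A}[1]$, with $\bar C$ spanned by the words $c=[a_d|\dots|a_1]$, $d\ge1$, of degree $|c|=\sum_i(|a_i|-1)$, with the deconcatenation coproduct, the differential $$d c=(-1)^{|c|}\sum(-1)^{|a_1|+\dots+|a_j|-j}[a_d|\dots|\bar{\mathfrak m}_i(a_{j+i},\dots,a_{j+1})|a_j|\dots|a_1]$$ and the curvature $h:\bar C\to\mathbf k_n$. For such a curved DG-coalgebra $C=\mathbf k_n\oplus\bar C$, $\Omega C$ is the tensor algebra over $\mathbf k_n$ on symbols $\langle c\rangle$, $c\in\bar C$, of degree $|c|+1$, with $$\partial\langle c\rangle=-h(c)-\langle dc\rangle-\sum(-1)^{|c''|}\langle c''\rangle\langle c'\rangle,$$ where $\sum c''\otimes c'$ is the reduced coproduct of $c$. **Lemma.** $\mathscr K_n$ satisfies the axioms of a strictly unital $A_\infty$-category, and $\mathscr I_n$ and $\Omega\mathrm B\mathscr K_n$ those of a DG-category. Moreover $\mathscr I_n$ is isomorphic to $\Omega\mathrm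 B\mathscr K_n$ as a DG-category, by an isomorphism sending $X_i$ to $Z_i$ (equivalently, as a DG-algebra over $\mathbf k_n$). In particular, there is a strictly unital $A_\infty$-functor $\mathfrak f:\mathscr K_n\to\mathscr I_n$ with $\mathfrak f(Z_i)=X_i$ that is a quasi-isomorphism, i.e. $\mathfrak f^1:\hom(Z_i,Z_j)\to\hom(X_i,X_j)$ induces an isomorphism on cohomology for all $i,j$. -/

import Mathlib

noncomputable section

namespace AInf

universe u

/-! ## Composable strings -/

/-- Composable strings of arrows of a quiver `Q` on the set of objects `O`.  `cons p a` is the string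
in which `a` comes *after* `p`; written right-to-left it is `(a, p)`. -/
inductive Str {O : Type} (Q : O → O → Type) : O → O → Type
  | nil (X : O) : Str Q X X
  | cons {X Y Z : O} (p : Str Q X Y) (a : Q Y Z) : Str Q X Z

namespace Str

variable {O : Type} {Q : O → O → Type}

/-- The string consisting of one arrow. -/
def one {X Y : O} (a : Q X Y) : Str Q X Y := cons (nil X) a

/-- The number of arrows of a string. -/
def len {X Y : O} : Str Q X Y → ℕ
  | nil _ => 0
  | cons p _ => p.len + 1

/-- The sum of the degrees of the arrows of a string. -/
def deg (d : ∀ {X Y : O}, Q X Y → ℤ) {X Y : O} : Str Q X Y → ℤ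
  | nil _ => 0
  | cons p a => p.deg d + d a

/-- The sum of the *shifted* degrees `|a| - 1` of the arrows of a string. -/
def sdeg (d : ∀ {X Y : O}, Q X Y → ℤ) {X Y : O} (p : Str Q X Y) : ℤ :=
  p.deg d - p.len

/-- Concatenation: `u.append t` is `u` followed by `t` (written right-to-left: `(t, u)`). -/
def append {X Y Z : O} (u : Str Q X Y) : Str Q Y Z → Str Q X Z
  | nil _ => u
  | cons t a => cons (append u t) a

/-- All ways of writing a string as `u` followed by `t`; `u` and `t` may be empty. -/
def splits {X Y : O} : Str Q X Y → List (Σ Z : O, Str Q X Z × Str Q Z Y)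
  | nil X => [⟨X, nil X, nil X⟩]
  | cons p a => ⟨_, cons p a, nil _⟩ ::
      (splits p).map (fun s => ⟨s.1, s.2.1, cons s.2.2 a⟩)

/-- The empty string, seen in `Str Q X Y` for `X = Y`. -/
def ofEq {X Y : O} (h : X = Y) : Str Q X Y := h ▸ nil X

theorem len_append {X Y Z : O} (u : Str Q X Y) (t : Str Q Y Z) :
    (u.append t).len = u.len + t.len := by
  induction t with
  | nil => rfl
  | cons t a ih => simp only [append, len, ih]; omega

/-- Replacing the middle part of a string by one arrow. -/
def insert {X Y Z W : O} (u : Str Q X Y) (a : Q Y Z) (t : Str Q Z W) : Str Q X W :=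
  (cons u a).append t

theorem insert_len_ne_zero {X Y Z W : O} (u : Str Q X Y) (a : Q Y Z) (t : Str Q Z W) :
    (u.insert a t).len ≠ 0 := by
  simp only [insert, len_append, len]; omega

/-- `∑ F u v t` over all decompositions of `p` into `u`, followed by a non-empty `v`, followed
by `t` (right-to-left: `p = (t, v, u)`). -/
def sum₃ {M : Type*} [AddCommMonoid M] {X Y : O} (p : Str Q X Y)
    (F : ∀ {Z W : O}, Str Q X Z → Str Q Z W → Str Q W Y → M) : M :=
  (p.splits.map fun s => (s.2.2.splits.map fun r =>
    if r.2.1.len = 0 then 0 else F s.2.1 r.2.1 r.2.2).sum).sum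

/-- `∑ F u t` over all decompositions of `p` into a non-empty `u` followed by a non-empty `t`
(right-to-left: `p = (t, u)`). -/
def sum₂ {M : Type*} [AddCommMonoid M] {X Y : O} (p : Str Q X Y)
    (F : ∀ {Z : O} (u : Str Q X Z) (t : Str Q Z Y), u.len ≠ 0 → t.len ≠ 0 → M) : M :=
  (p.splits.map fun s =>
    if h : s.2.1.len ≠ 0 ∧ s.2.2.len ≠ 0 then F s.2.1 s.2.2 h.1 h.2 else 0).sum

end Str

/-! ## DG-categories -/

/-- The data of a `K`-linear DG-category (cohomological grading) with set of objects `O`. The axioms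
are in `DGCat.IsDG`.  `comp a₂ a₁` is the composition `a₂ a₁` (first `a₁`, then `a₂`). For finite
`O` this is the same as the data of a DG-algebra over the semisimple ring `⊕_{X ∈ O} K e_X`. -/
structure DGCat (K : Type u) [Field K] (O : Type) where
  Hom : O → O → Type u
  [acg : ∀ X Y, AddCommGroup (Hom X Y)]
  [mod : ∀ X Y, Module K (Hom X Y)]
  gr : ∀ X Y, ℤ → Submodule K (Hom X Y)
  id : ∀ X, Hom X X
  comp : ∀ {X Y Z}, Hom Y Z →ₗ[K] Hom X Y →ₗ[K] Hom X Z
  d : ∀ {X Y}, Hom X Y →ₗ[K] Hom X Y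

attribute [instance] DGCat.acg DGCat.mod

/-- The axioms of a DG-category. -/
structure DGCat.IsDG {K : Type u} [Field K] {O : Type} (D : DGCat K O) : Prop where
  internal : ∀ X Y, DirectSum.IsInternal (D.gr X Y)
  id_comp : ∀ {X Y} (a : D.Hom X Y), D.comp (D.id Y) a = a
  comp_id : ∀ {X Y} (a : D.Hom X Y), D.comp a (D.id X) = a
  assoc : ∀ {X Y Z W} (a₃ : D.Hom Z W) (a₂ : D.Hom Y Z) (a₁ : D.Hom X Y),
    D.comp (D.comp a₃ a₂) a₁ = D.comp a₃ (D.comp a₂ a₁)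
  id_mem : ∀ X, D.id X ∈ D.gr X X 0
  comp_mem : ∀ {X Y Z} {i j : ℤ} {a₂ : D.Hom Y Z} {a₁ : D.Hom X Y},
    a₂ ∈ D.gr Y Z i → a₁ ∈ D.gr X Y j → D.comp a₂ a₁ ∈ D.gr X Z (i + j)
  d_mem : ∀ {X Y} {i : ℤ} {a : D.Hom X Y}, a ∈ D.gr X Y i → D.d a ∈ D.gr X Y (i + 1)
  d_d : ∀ {X Y} (a : D.Hom X Y), D.d (D.d a) = 0
  leibniz : ∀ {X Y Z} {i : ℤ} {a₂ : D.Hom Y Z} (a₁ : D.Hom X Y), a₂ ∈ D.gr Y Z i →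
    D.d (D.comp a₂ a₁) = D.comp (D.d a₂) a₁ + (-1 : K) ^ i • D.comp a₂ (D.d a₁)

/-- An isomorphism of DG-categories that is the identity on objects (equivalently, for finite `O`, an
isomorphism of DG-algebras over `⊕_{X ∈ O} K e_X`). -/
structure DGIso {K : Type u} [Field K] {O : Type} (D E : DGCat K O) where
  toEquiv : ∀ X Y, D.Hom X Y ≃ₗ[K] E.Hom X Y
  map_id : ∀ X, toEquiv X X (D.id X) = E.id X
  map_comp : ∀ {X Y Z} (a₂ : D.Hom Y Z) (a₁ : D.Hom X Y),
    toEquiv X Z (D.comp a₂ a₁) = E.comp (toEquiv Y Z a₂) (toEquiv X Y a₁)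
  map_d : ∀ {X Y} (a : D.Hom X Y), toEquiv X Y (D.d a) = E.d (toEquiv X Y a)
  map_gr : ∀ {X Y} {i : ℤ} (a : D.Hom X Y), toEquiv X Y a ∈ E.gr X Y i ↔ a ∈ D.gr X Y i

/-! ### The free category on a graded quiver, with a differential given on generators -/

section Free

variable {K : Type u} [Field K] {O : Type} {P : O → O → Type}

/-- Composition in the free `K`-linear category on `P`: concatenation of strings. -/
def freeComp {X Y Z : O} :
    (Str P Y Z →₀ K) →ₗ[K] (Str P X Y →₀ K) →ₗ[K] (Str P X Z →₀ K) :=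
  Finsupp.lsum K fun t => (LinearMap.lsmul K _).flip
    (Finsupp.lmapDomain K K fun u : Str P X Y => u.append t)

/-- `δ_{XY}`: the identity morphism if `X = Y`, and `0` otherwise. -/
def freeDelta [DecidableEq O] (X Y : O) : Str P X Y →₀ K :=
  if h : X = Y then Finsupp.single (Str.ofEq h) 1 else 0

/-- Extension of a map on generators to strings by the graded Leibniz rule
`∂(a₂ a₁) = ∂(a₂) a₁ + (-1)^|a₂| a₂ ∂(a₁)`. -/
def freeDStr (deg : ∀ {X Y : O}, P X Y → ℤ) (dgen : ∀ {X Y : O}, P X Y → (Str P X Y →₀ K))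
    {X Y : O} : Str P X Y → (Str P X Y →₀ K)
  | .nil _ => 0
  | .cons p a => freeComp (dgen a) (Finsupp.single p 1) +
      (-1 : K) ^ deg a • freeComp (Finsupp.single (Str.one a) 1) (freeDStr deg dgen p)

/-- The category freely generated over `K` by the graded quiver `P`, with the derivation whose
values on the generators are `dgen`. -/
def freeDG (P : O → O → Type) (deg : ∀ {X Y : O}, P X Y → ℤ)
    (dgen : ∀ {X Y : O}, P X Y → (Str P X Y →₀ K)) : DGCat K O where
  Hom X Y := Str P X Y →₀ K
  gr X Y i := Finsupp.supported K K {p : Str P X Y | p.deg deg = i}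
  id X := Finsupp.single (Str.nil X) 1
  comp := freeComp
  d := Finsupp.linearCombination K (freeDStr deg dgen)

end Free

/-! ## Strictly unital A∞-categories -/

/-- The basis of `hom(X, Y)` that consists of the arrows of `Q`, together with the unit `e X` if
`X = Y`. -/
inductive UBasis {O : Type} (Q : O → O → Type) : O → O → Type
  | e (X : O) : UBasis Q X X
  | gen {X Y : O} (a : Q X Y) : UBasis Q X Y

section

variable {O : Type} {Q : O → O → Type}

/-- Degrees of basis morphisms; units have degree `0`. -/
def UBasis.deg (d : ∀ {X Y : O}, Q X Y → ℤ) {X Y : O} : UBasis Q X Y → ℤ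
  | .e _ => 0
  | .gen a => d a

/-- The unit, seen in `UBasis Q X Y` for `X = Y`. -/
def UBasis.ofEq {X Y : O} (h : X = Y) : UBasis Q X Y := h ▸ UBasis.e X

theorem UBasis.gen_injective {X Y : O} :
    Function.Injective (UBasis.gen : Q X Y → UBasis Q X Y) := by
  intro a b h
  cases h
  rfl

/-- Appending a basis morphism to a string of arrows of `Q`; `none` if it is a unit. -/
def UBasis.snoc? {X Y Z : O} (q : Str Q X Y) : UBasis Q Y Z → Option (Str Q X Z)
  | .e _ => none
  | .gen a => some (q.cons a)

/-- A string of basis morphisms none of which is a unit, seen as a string of arrows of `Q`;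
`none` if a unit occurs. -/
def Str.toGen? {X Y : O} : Str (UBasis Q) X Y → Option (Str Q X Y)
  | .nil _ => some (.nil _)
  | .cons p b => (toGen? p).bind fun q => UBasis.snoc? q b

end

/-- The data of a strictly unital `K`-linear A∞-category with set of objects `O` whose hom spaces come
with homogeneous bases containing the units: `hom(X, Y)` has the basis `UBasis Q X Y`. By strict
unitality the (multilinear) operations are determined by their values on strings of non-unit
basis morphisms; `m p` is `𝔪_d(a_d, …, a_1)` for such a string `p = (a_d, …, a_1)`.  The full
operations are `AInfCat.op` and the axioms are in `AInfCat.IsAInf`. -/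
structure AInfCat (K : Type u) [Field K] (O : Type) where
  Q : O → O → Type
  deg : ∀ {X Y : O}, Q X Y → ℤ
  m : ∀ {X Y : O}, Str Q X Y → (UBasis Q X Y →₀ K)

namespace AInfCat

variable {K : Type u} [Field K] {O : Type} (A : AInfCat K O)

/-- The basis of the morphism spaces. -/
abbrev B (X Y : O) : Type := UBasis A.Q X Y

/-- The morphism spaces. -/
abbrev Hom (X Y : O) : Type u := A.B X Y →₀ K

/-- Degrees of the basis morphisms. -/
def bdeg {X Y : O} (b : A.B X Y) : ℤ := b.deg A.deg

/-- The operations `𝔪_d` on all strings of basis morphisms, units being strict: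
`𝔪_2(a, e) = a`, `𝔪_2(e, a) = (-1)^|a| a`, and every other operation with a unit among its inputs
vanishes. -/
def op {X Y : O} : Str A.B X Y → A.Hom X Y
  | .cons (.cons (.nil _) (.e _)) a => Finsupp.single a 1
  | .cons (.cons (.nil _) (.gen a)) (.e _) => (-1 : K) ^ A.deg a • Finsupp.single (.gen a) 1
  | p => match p.toGen? with
    | some q => A.m q
    | none => 0

/-- The axioms of a strictly unital A∞-category: no curvature, `𝔪_d` has degree `2 - d`, and
`∑ (-1)^(|a_1| + … + |a_j| - j) 𝔪_{d-i+1}(a_d, …, 𝔪_i(a_{j+i}, …, a_{j+1}), a_j, …, a_1) = 0`. -/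
structure IsAInf : Prop where
  no_curv : ∀ X, A.m (Str.nil X) = 0
  op_deg : ∀ {X Y} (p : Str A.B X Y) (b : A.B X Y), b ∈ (A.op p).support →
    A.bdeg b = p.deg A.bdeg + 2 - p.len
  rel : ∀ {X Y} (p : Str A.B X Y),
    p.sum₃ (fun u v t => (-1 : K) ^ u.sdeg A.bdeg •
      (A.op v).sum fun b c => c • A.op (u.insert b t)) = 0

/-- The first operation `𝔪_1` as a linear endomorphism of `hom(X, Y)`. -/
def m₁ (X Y : O) : A.Hom X Y →ₗ[K] A.Hom X Y :=
  Finsupp.linearCombination K fun b => A.op (Str.one b)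

end AInfCat

/-- Strictly unital A∞-functors, identical on objects, from an A∞-category `A` to a DG-category `D`.
The latter is an A∞-category with `𝔪_1(a) = (-1)^|a| ∂ a`, `𝔪_2(a₂, a₁) = (-1)^|a₁| a₂ a₁` and no
higher operations.  `F p` is `𝔣^d(a_d, …, a_1)` for a non-empty string of basis morphisms, of
degree `|a_1| + … + |a_d| + 1 - d`, and the functor equation is
`𝔪_1(𝔣(a_d, …, a_1)) + ∑ 𝔪_2(𝔣(a_d, …, a_{j+1}), 𝔣(a_j, …, a_1))
  = ∑ (-1)^(|a_1| + … + |a_j| - j) 𝔣(a_d, …, 𝔪_i(a_{j+i}, …, a_{j+1}), a_j, …, a_1)`. -/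
structure AInfFunctor {K : Type u} [Field K] {O : Type} (A : AInfCat K O) (D : DGCat K O) where
  F : ∀ {X Y : O}, Str A.B X Y → D.Hom X Y
  F_deg : ∀ {X Y} (p : Str A.B X Y), p.len ≠ 0 → F p ∈ D.gr X Y (p.sdeg A.bdeg + 1)
  F_eq : ∀ {X Y} (p : Str A.B X Y), p.len ≠ 0 →
    (-1 : K) ^ (p.sdeg A.bdeg + 1) • D.d (F p) +
      p.sum₂ (fun u t _ _ => (-1 : K) ^ (u.sdeg A.bdeg + 1) • D.comp (F t) (F u)) =
    p.sum₃ (fun u v t => (-1 : K) ^ u.sdeg A.bdeg •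
      (A.op v).sum fun b c => c • F (u.insert b t))
  F_unit : ∀ X, F (Str.one (UBasis.e X)) = D.id X
  F_unit_higher : ∀ {X Y Z} (u : Str A.B X Y) (t : Str A.B Y Z), u.len + t.len ≠ 0 →
    F (u.insert (UBasis.e Y) t) = 0

namespace AInfFunctor

variable {K : Type u} [Field K] {O : Type} {A : AInfCat K O} {D : DGCat K O}

/-- The linear part `𝔣^1` of an A∞-functor. -/
def F₁ (f : AInfFunctor A D) (X Y : O) : A.Hom X Y →ₗ[K] D.Hom X Y :=
  Finsupp.linearCombination K fun b => f.F (Str.one b)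

/-- `f` is a quasi-isomorphism: for all objects `X`, `Y` the map that `𝔣^1` induces from the
cohomology of `(hom_A(X, Y), 𝔪_1)` to that of `(hom_D(X, Y), ∂)` is injective and surjective. -/
def IsQuasiIso (f : AInfFunctor A D) : Prop :=
  ∀ X Y : O,
    (∀ a : A.Hom X Y, A.m₁ X Y a = 0 → (∃ y : D.Hom X Y, f.F₁ X Y a = D.d y) →
      ∃ a', a = A.m₁ X Y a') ∧
    (∀ y : D.Hom X Y, D.d y = 0 →
      ∃ (a : A.Hom X Y) (z : D.Hom X Y), A.m₁ X Y a = 0 ∧ y = f.F₁ X Y a + D.d z)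

end AInfFunctor

/-! ## Bar and cobar constructions -/

/-- The data of a coaugmented curved DG-cocategory `C = k ⊕ C̄` over `k = ⊕_X K e_X`, in terms of a
homogeneous basis `P` of `C̄`: the differential `d`, the reduced comultiplication
`Δ c = ∑ c'' ⊗ c'` (a linear combination of pairs in which `c' : X → Z` is listed first and
`c'' : Z → Y` second), and the curvature `h : C̄ → k`, where `h c` is the coefficient of `e_X` for
`c : X → X`, and is not used for `c : X → Y` with `X ≠ Y`. -/
structure CurvedCocat (K : Type u) [Field K] (O : Type) where
  P : O → O → Type
  deg : ∀ {X Y : O}, P X Y → ℤ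
  d : ∀ {X Y : O}, P X Y → (P X Y →₀ K)
  Δ : ∀ {X Y : O}, P X Y → ((Σ Z : O, P X Z × P Z Y) →₀ K)
  h : ∀ {X Y : O}, P X Y → K

/-- The coefficient of the unit in a morphism of `A`; `0` if `X ≠ Y`. -/
def unitCoeff {K : Type u} [Field K] {O : Type} [DecidableEq O] {Q : O → O → Type} {X Y : O}
    (f : UBasis Q X Y →₀ K) : K :=
  if h : X = Y then f (UBasis.ofEq h) else 0

/-- The component of a morphism of `A` in the span `Ā` of the non-unit basis morphisms. -/
def genPart {K : Type u} [Field K] {O : Type} {Q : O → O → Type} {X Y : O}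
    (f : UBasis Q X Y →₀ K) : Q X Y →₀ K :=
  Finsupp.comapDomain UBasis.gen f UBasis.gen_injective.injOn

/-- The (reduced) bar construction of a strictly unital A∞-category `A = k ⊕ Ā`: the tensor
coalgebra of the shift of `Ā` over `k`.  Its reduced part has as basis the non-empty strings
`c = [a_d | … | a_1]` of non-unit basis morphisms, of degree `∑ (|a_i| - 1)`. The comultiplication is
deconcatenation.  Write `𝔪 = 𝔪̄ + h` for the components of the operations in `Ā` and in `k`. The
differential is
`d c = (-1)^|c| ∑ (-1)^(|a_1| + … + |a_j| - j) [a_d | … | 𝔪̄_i(a_{j+i}, …, a_{j+1}) | a_j | … | a_1]`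
and the curvature is `h`; it vanishes precisely if `A → k` is a strict augmentation. -/
def bar {K : Type u} [Field K] {O : Type} [DecidableEq O] (A : AInfCat K O) : CurvedCocat K O where
  P X Y := {p : Str A.Q X Y // p.len ≠ 0}
  deg p := p.1.sdeg A.deg
  d p := (-1 : K) ^ p.1.sdeg A.deg • p.1.sum₃ (fun u v t => (-1 : K) ^ u.sdeg A.deg •
    (genPart (A.m v)).sum fun a c =>
      Finsupp.single ⟨u.insert a t, Str.insert_len_ne_zero u a t⟩ c)
  Δ p := p.1.sum₂ fun u t hu ht => Finsupp.single ⟨_, ⟨u, hu⟩, ⟨t, ht⟩⟩ 1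
  h p := unitCoeff (A.m p.1)

/-- The cobar construction of a coaugmented curved DG-cocategory `C = k ⊕ C̄`: the free category
(tensor algebra over `k`) on the symbols `⟨c⟩`, of degree `|c| + 1`, with
`∂⟨c⟩ = - h(c) - ⟨d c⟩ - ∑ (-1)^|c''| ⟨c''⟩ ⟨c'⟩`. -/
def cobar {K : Type u} [Field K] {O : Type} [DecidableEq O] (C : CurvedCocat K O) : DGCat K O :=
  freeDG C.P (fun c => C.deg c + 1) fun {X Y} c =>
    - (C.h c • freeDelta X Y)
    - Finsupp.mapDomain Str.one (C.d c)
    - (C.Δ c).sum fun s r => ((-1 : K) ^ C.deg s.2.2 * r) •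
        Finsupp.single (((Str.nil X).cons s.2.1).cons s.2.2) 1

/-! ## The internal DG-category `I_n` -/

/-- The index `p` of a generator `c^p_{ij} : X_i → X_j`: any `p ≥ 1`, and also `p = 0` if `i < j`. -/
abbrev CGen (n : ℕ) (i j : Fin n) : Type := {p : ℕ // 1 ≤ p ∨ i < j}

/-- `c^p_{ij}` as a morphism of the free category; `c^0_{ij} = 0` for `i ≥ j`. -/
def cElt (K : Type u) [Field K] {n : ℕ} (p : ℕ) (i j : Fin n) : Str (CGen n) i j →₀ K :=
  if h : 1 ≤ p ∨ i < j then Finsupp.single (Str.one (⟨p, h⟩ : CGen n i j)) 1 else 0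

/-- The internal DG-category `I_n`, with objects `X_1, …, X_n`, freely generated by the `c^p_{ij}`
of degree `1 - 2p + m_j - m_i`, with
`∂ c^p_{ij} = δ_{p1} δ_{ij} + ∑_{0 ≤ q ≤ p} ∑_r (-1)^(m_r + m_j) c^{p-q}_{rj} c^q_{ir}`. -/
def internalDG (K : Type u) [Field K] (n : ℕ) (m : Fin n → ℤ) : DGCat K (Fin n) :=
  freeDG (CGen n) (fun {i j} p => 1 - 2 * (p.1 : ℤ) + m j - m i) fun {i j} p =>
    (if p.1 = 1 then freeDelta i j else 0) +
    ∑ q ∈ Finset.range (p.1 + 1), ∑ r : Fin n,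
      (-1 : K) ^ (m r + m j) • freeComp (cElt K (p.1 - q) r j) (cElt K q i r)

/-! ## Kontsevich's A∞-category `K_n` -/

/-- The arrows `x_i : Z_i → Z_{i+1}`, where indices are added modulo `n`. -/
inductive XGen (n : ℕ) [NeZero n] : Fin n → Fin n → Type
  | x (i : Fin n) : XGen n i (i + 1)

/-- `|x_i| = 1 + m_{i+1} - m_i`, except that the arrow from the last object to the first one has
degree `-1 + m_1 - m_n`. -/
def XGen.deg {n : ℕ} [NeZero n] (m : Fin n → ℤ) : ∀ {i j : Fin n}, XGen n i j → ℤ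
  | _, _, .x i => (if (i : ℕ) + 1 = n then -1 else 1) + m (i + 1) - m i

/-- Kontsevich's A∞-category `K_n`: the morphisms are spanned by the units `e_i` and the `x_i`, and the
only operation without units among its inputs is `𝔪_n(x_{i-1}, …, x_{i+1}, x_i) = e_i`. (A string of
`n` of the arrows goes once around the circle, so it starts and ends at the same object.) -/
def kontsevich (K : Type u) [Field K] (n : ℕ) [NeZero n] (m : Fin n → ℤ) :
    AInfCat K (Fin n) where
  Q := XGen n
  deg := XGen.deg m
  m {i j} p :=
    if h : p.len = n ∧ i = j then Finsupp.single (UBasis.ofEq h.2) 1 else 0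

end AInf

end

/-! The arrows `x_i` form an oriented circle. A path on it is determined by its source `i`, its
target `j` and the number `p` of passages from the last object to the first; its length is `p * n +
j - i`. It is non-empty exactly when `1 ≤ p ∨ i < j`, which is the condition on the index of
`c^p_{ij}`. Thus the basis words of the reduced bar construction are the generators of `I_n`, and
the degrees agree because each `x` contributes `-2 * wrap + m_j - m_i` to the shifted degree.

All operations of `K_n` on non-units take values in the span of the units. Hence the bar
differential vanishes. The curvature is supported on the closed paths of winding number one and
gives the term `δ_{p1} δ_{ij}`, while deconcatenation of paths gives the quadratic term. Sending
`⟨c⟩` to `-c^p_{ij}` absorbs the remaining signs (`freeNegEquiv_cobarDiff`). The DG axioms for `I_n`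
reduce to `∂∂ = 0` on generators (`cD_cDiff`), and those for the cobar construction follow by
transport (`DGIso.isDG`).

For the A∞-relations the operations are split into products with units (`opU`) and the rest (`opC`).
Inserting products with units telescopes, leaving only contributions of units at the two ends of a
string (`insertSum_opU_eq`). This handles both the relations of `K_n` and the equation of the
functor that sends a path to `-c^p_{ij}` and a unit to the identity.

For the quasi-isomorphism, let `c^p_{ij}` have length `p * n + j - i`. The quadratic part of `∂`
preserves total length and the constant term lowers it. The homotopy that merges a last generator of
length one into its neighbour satisfies `∂h + h∂ = id` modulo shorter strings on every string of
total length at least two (`homotopy_identity`). Induction on the length reduces cohomology to the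
subcomplex of strings of length at most one. It is spanned by identities and length-one generators,
and the linear part of the functor maps `K_n` bijectively onto it. -/

noncomputable section

namespace AInf

universe u

/-! ### Free linear categories on a graded quiver -/

section Free

namespace Str

variable {O : Type} {Q : O → O → Type}

@[simp] theorem append_nil {X Y : O} (u : Str Q X Y) : u.append (nil Y) = u := rfl

@[simp] theorem append_cons {X Y Z W : O} (u : Str Q X Y) (t : Str Q Y Z) (a : Q Z W) :
    u.append (t.cons a) = (u.append t).cons a := rfl

@[simp] theorem nil_append {X Y : O} (t : Str Q X Y) : (nil X).append t = t := by
  induction t with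
  | nil => rfl
  | cons t a ih => rw [append_cons, ih]

theorem append_assoc {X Y Z W : O} (u : Str Q X Y) (t : Str Q Y Z) (s : Str Q Z W) :
    (u.append t).append s = u.append (t.append s) := by
  induction s with
  | nil => rfl
  | cons s a ih => simp only [append_cons, ih]

theorem deg_append (d : ∀ {X Y : O}, Q X Y → ℤ) {X Y Z : O} (u : Str Q X Y) (t : Str Q Y Z) :
    (u.append t).deg d = u.deg d + t.deg d := by
  induction t with
  | nil => simp [deg]
  | cons t a ih => simp only [append_cons, deg, ih]; ring

/-- The map on strings induced by a map of quivers. -/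
def map {P : O → O → Type} (e : ∀ X Y, Q X Y → P X Y) {X Y : O} : Str Q X Y → Str P X Y
  | nil X => nil X
  | cons p a => (map e p).cons (e _ _ a)

theorem map_append {P : O → O → Type} (e : ∀ X Y, Q X Y → P X Y) {X Y Z : O}
    (u : Str Q X Y) (t : Str Q Y Z) : (u.append t).map e = (u.map e).append (t.map e) := by
  induction t with
  | nil => rfl
  | cons t a ih => simp only [append_cons, map, ih]

/-- The bijection on strings induced by an isomorphism of quivers. -/
def mapEquiv {P : O → O → Type} (e : ∀ X Y, Q X Y ≃ P X Y) (X Y : O) : Str Q X Y ≃ Str P X Y where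
  toFun := map fun X Y => e X Y
  invFun := map fun X Y => (e X Y).symm
  left_inv p := by induction p with
    | nil => rfl
    | cons p a ih => simp only [map, ih, Equiv.symm_apply_apply]
  right_inv p := by induction p with
    | nil => rfl
    | cons p a ih => simp only [map, ih, Equiv.apply_symm_apply]

end Str

variable {K : Type u} [Field K] {O : Type} {P : O → O → Type}

theorem freeComp_single_single {X Y Z : O} (t : Str P Y Z) (a : K) (u : Str P X Y) (b : K) :
    freeComp (Finsupp.single t a) (Finsupp.single u b) = Finsupp.single (u.append t) (a * b) := by
  simp [freeComp, Finsupp.mapDomain_single]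

theorem freeComp_nil_left {X Y : O} (y : Str P X Y →₀ K) :
    freeComp (Finsupp.single (Str.nil Y) 1) y = y := by
  induction y using Finsupp.induction_linear with
  | zero => simp
  | add f g hf hg => simp [hf, hg]
  | single u b => simp [freeComp_single_single]

theorem freeComp_nil_right {X Y : O} (y : Str P X Y →₀ K) :
    freeComp y (Finsupp.single (Str.nil X) 1) = y := by
  induction y using Finsupp.induction_linear with
  | zero => simp
  | add f g hf hg => simp [hf, hg]
  | single u b => simp [freeComp_single_single]

theorem freeComp_assoc {X Y Z W : O} (z : Str P Z W →₀ K) (y : Str P Y Z →₀ K)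
    (x : Str P X Y →₀ K) : freeComp (freeComp z y) x = freeComp z (freeComp y x) := by
  induction z using Finsupp.induction_linear with
  | zero => simp
  | add f g hf hg => simp [hf, hg]
  | single s c =>
    induction y using Finsupp.induction_linear with
    | zero => simp
    | add f g hf hg => simp [hf, hg]
    | single t b =>
      induction x using Finsupp.induction_linear with
      | zero => simp
      | add f g hf hg => simp [hf, hg]
      | single u a => simp only [freeComp_single_single, Str.append_assoc, mul_assoc]

theorem single_cons {X Y Z : O} (p : Str P X Y) (a : P Y Z) (c : K) :
    Finsupp.single (p.cons a) c =
      freeComp (Finsupp.single (Str.one a) 1) (Finsupp.single p c) := by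
  rw [freeComp_single_single, one_mul]; rfl

theorem freeComp_mem {f : ∀ {X Y : O}, Str P X Y → ℤ}
    (hf : ∀ {X Y Z : O} (u : Str P X Y) (t : Str P Y Z), f (u.append t) = f t + f u)
    {X Y Z : O} {i j : ℤ} {y : Str P Y Z →₀ K} {x : Str P X Y →₀ K}
    (hy : y ∈ Finsupp.supported K K {p | f p = i}) (hx : x ∈ Finsupp.supported K K {p | f p = j}) :
    freeComp y x ∈ Finsupp.supported K K {p : Str P X Z | f p = i + j} := by
  rw [Finsupp.supported_eq_span_single] at hy hx
  induction hy using Submodule.span_induction with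
  | zero => simp
  | add a b _ _ ha hb => rw [map_add, LinearMap.add_apply]; exact add_mem ha hb
  | smul c a _ ha => rw [map_smul, LinearMap.smul_apply]; exact Submodule.smul_mem _ _ ha
  | mem y hy =>
    obtain ⟨t, ht, rfl⟩ := hy
    induction hx using Submodule.span_induction with
    | zero => simp
    | add a b _ _ ha hb => rw [map_add]; exact add_mem ha hb
    | smul c a _ ha => rw [map_smul]; exact Submodule.smul_mem _ _ ha
    | mem x hx =>
      obtain ⟨u, hu, rfl⟩ := hx
      rw [freeComp_single_single]
      refine Finsupp.single_mem_supported _ _ ?_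
      simp only [Set.mem_ofPred_eq] at ht hu ⊢
      rw [hf, ht, hu]

/-- The fibres of `f` partition the basis, so the spans they support are independent and exhaust the
space. -/
theorem isInternal_supported_fiber {α : Type*} (f : α → ℤ) :
    DirectSum.IsInternal fun i : ℤ => Finsupp.supported K K {p : α | f p = i} := by
  rw [DirectSum.isInternal_submodule_iff_iSupIndep_and_iSup_eq_top]
  constructor
  · intro i
    have : (⨆ (j : ℤ) (_ : j ≠ i), Finsupp.supported K K {p : α | f p = j}) ≤
        Finsupp.supported K K {p | f p ≠ i} := by
      refine iSup₂_le fun j hj => Finsupp.supported_mono ?_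
      rintro p rfl
      exact hj
    refine Disjoint.mono_right this (Finsupp.disjoint_supported_supported ?_)
    rw [Set.disjoint_left]
    intro p hp hp'
    exact hp' hp
  · rw [← Finsupp.supported_iUnion, eq_top_iff]
    intro y _
    rw [Finsupp.mem_supported]
    intro p _
    simp

/-! ### The derivation with prescribed values on generators -/

variable {deg : ∀ {X Y : O}, P X Y → ℤ} {dgen : ∀ {X Y : O}, P X Y → (Str P X Y →₀ K)}

variable (deg dgen) in
/-- The differential of `freeDG`. -/
abbrev freeD {X Y : O} : (Str P X Y →₀ K) →ₗ[K] (Str P X Y →₀ K) :=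
  Finsupp.linearCombination K (freeDStr deg dgen)

theorem freeD_nil (X : O) : freeD deg dgen (Finsupp.single (Str.nil X) (1 : K)) = 0 := by
  simp [freeDStr]

theorem freeD_one {X Y : O} (a : P X Y) :
    freeD deg dgen (Finsupp.single (Str.one a) (1 : K)) = dgen a := by
  simp [freeDStr, Str.one, freeComp_nil_right]

theorem freeD_comp_one {X Y Z : O} (a : P Y Z) (y : Str P X Y →₀ K) :
    freeD deg dgen (freeComp (Finsupp.single (Str.one a) 1) y) =
      freeComp (dgen a) y +
        (-1 : K) ^ deg a • freeComp (Finsupp.single (Str.one a) 1) (freeD deg dgen y) := by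
  induction y using Finsupp.induction_linear with
  | zero => simp
  | add f g hf hg => simp only [map_add, hf, hg, smul_add]; abel
  | single u b =>
    have : Finsupp.single u b = b • Finsupp.single u (1 : K) := by simp
    rw [this]
    simp only [map_smul]
    rw [← single_cons, Finsupp.linearCombination_single, Finsupp.linearCombination_single,
      one_smul, one_smul, freeDStr, smul_comm _ b, smul_add]

/-- By linearity the left factor is a string. Induction peels off its last arrow, and
`freeD_comp_one` is applied before and after reassociating. -/
theorem freeD_comp {X Y Z : O} {i : ℤ} {y : Str P Y Z →₀ K} (x : Str P X Y →₀ K)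
    (hy : y ∈ Finsupp.supported K K {p | p.deg deg = i}) :
    freeD deg dgen (freeComp y x) =
      freeComp (freeD deg dgen y) x + (-1 : K) ^ i • freeComp y (freeD deg dgen x) := by
  rw [Finsupp.supported_eq_span_single] at hy
  induction hy using Submodule.span_induction with
  | zero => simp
  | add a b _ _ ha hb => simp only [map_add, LinearMap.add_apply, ha, hb, smul_add]; abel
  | smul c a _ ha => simp only [map_smul, LinearMap.smul_apply, ha, smul_add, smul_comm c]
  | mem y hy =>
    obtain ⟨t, rfl, rfl⟩ := hy
    clear y
    induction t with
    | nil => rw [freeD_nil, freeComp_nil_left, freeComp_nil_left]; simp [Str.deg]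
    | cons t a ih =>
      beta_reduce at ih ⊢
      rw [single_cons, freeComp_assoc, freeD_comp_one, ih, freeD_comp_one]
      simp only [map_add, map_smul, LinearMap.add_apply, LinearMap.smul_apply, freeComp_assoc,
        Str.deg, smul_add, smul_smul]
      rw [zpow_add₀ (by simp), mul_comm]
      abel

theorem freeD_mem (hdeg : ∀ {X Y : O} (a : P X Y),
      dgen a ∈ Finsupp.supported K K {p : Str P X Y | p.deg deg = deg a + 1})
    {X Y : O} {i : ℤ} {y : Str P X Y →₀ K}
    (hy : y ∈ Finsupp.supported K K {p | p.deg deg = i}) :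
    freeD deg dgen y ∈ Finsupp.supported K K {p | p.deg deg = i + 1} := by
  have happ : ∀ {X Y Z : O} (u : Str P X Y) (t : Str P Y Z),
      (u.append t).deg deg = t.deg deg + u.deg deg := fun u t => by
    rw [Str.deg_append, add_comm]
  rw [Finsupp.supported_eq_span_single] at hy
  induction hy using Submodule.span_induction with
  | zero => simp
  | add a b _ _ ha hb => rw [map_add]; exact add_mem ha hb
  | smul c a _ ha => rw [map_smul]; exact Submodule.smul_mem _ _ ha
  | mem y hy =>
    obtain ⟨t, rfl, rfl⟩ := hy
    clear y
    induction t with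
    | nil => rw [freeD_nil]; exact zero_mem _
    | cons t a ih =>
      beta_reduce at ih ⊢
      rw [single_cons, freeD_comp_one]
      refine add_mem ?_ (Submodule.smul_mem _ _ ?_)
      · have h : deg a + 1 + t.deg deg = (t.cons a).deg deg + 1 := by
          change _ = t.deg deg + deg a + 1; ring
        rw [← h]
        exact freeComp_mem happ (hdeg a) (Finsupp.single_mem_supported K (1 : K) rfl)
      · have h : deg a + (t.deg deg + 1) = (t.cons a).deg deg + 1 := by
          change _ = t.deg deg + deg a + 1; ring
        rw [← h]
        exact freeComp_mem happ (Finsupp.single_mem_supported K (1 : K)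
          (show Str.one a ∈ {p | p.deg deg = deg a} by simp [Str.one, Str.deg])) ih

/-- Induction on strings: in `∂∂(a p)` the mixed term `∂a ∂p` occurs with the signs `(-1)^(|a|+1)`
and `(-1)^|a|`, and the other terms vanish by `hdd` and by induction. -/
theorem freeD_freeD (hdeg : ∀ {X Y : O} (a : P X Y),
      dgen a ∈ Finsupp.supported K K {p : Str P X Y | p.deg deg = deg a + 1})
    (hdd : ∀ {X Y : O} (a : P X Y), freeD deg dgen (dgen a) = 0)
    {X Y : O} (y : Str P X Y →₀ K) : freeD deg dgen (freeD deg dgen y) = 0 := by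
  induction y using Finsupp.induction_linear with
  | zero => simp
  | add f g hf hg => rw [map_add, map_add, hf, hg, add_zero]
  | single t b =>
    have : Finsupp.single t b = b • Finsupp.single t (1 : K) := by simp
    rw [this, map_smul, map_smul]
    refine smul_eq_zero_of_right _ ?_
    clear this
    induction t with
    | nil => rw [freeD_nil, map_zero]
    | cons t a ih =>
      rw [single_cons, freeD_comp_one, map_add, map_smul, freeD_comp_one, ih,
        freeD_comp _ (hdeg a), hdd, map_zero, map_zero, LinearMap.zero_apply, zero_add, smul_zero,
        add_zero, zpow_add₀ (by simp), ← add_smul]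
      simp

/-- A free category with a derivation of degree one that squares to zero on the generators is a
DG-category. -/
theorem freeDG_isDG (hdeg : ∀ {X Y : O} (a : P X Y),
      dgen a ∈ Finsupp.supported K K {p : Str P X Y | p.deg deg = deg a + 1})
    (hdd : ∀ {X Y : O} (a : P X Y), freeD deg dgen (dgen a) = 0) :
    (freeDG P deg dgen).IsDG where
  internal _ _ := isInternal_supported_fiber _
  id_comp := freeComp_nil_left
  comp_id := freeComp_nil_right
  assoc := freeComp_assoc
  id_mem _ := Finsupp.single_mem_supported _ _ rfl
  comp_mem := freeComp_mem fun u t => by rw [Str.deg_append, add_comm]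
  d_mem := freeD_mem hdeg
  d_d := freeD_freeD hdeg hdd
  leibniz := freeD_comp

/-! ### Isomorphisms of free categories -/

variable {P' : O → O → Type} {deg' : ∀ {X Y : O}, P' X Y → ℤ}
  {dgen' : ∀ {X Y : O}, P' X Y → (Str P' X Y →₀ K)}

/-- This map is the substitution of `-a` for every generator `a`. -/
theorem linearCombination_neg_one_pow_len_involutive (X Y : O) :
    Function.Involutive (Finsupp.linearCombination K
      fun p : Str P X Y => (-1 : K) ^ p.len • Finsupp.single p (1 : K)) := by
  intro y
  induction y using Finsupp.induction_linear with
  | zero => simp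
  | add f g hf hg => rw [map_add, map_add, hf, hg]
  | single t b =>
    rw [Finsupp.linearCombination_single, map_smul, map_smul,
      Finsupp.linearCombination_single, one_smul, smul_smul _ _ (Finsupp.single t (1 : K)),
      ← pow_add, Even.neg_one_pow ⟨_, rfl⟩, one_smul, Finsupp.smul_single_one]

/-- The isomorphism of free categories that sends each generator `a` to `-(e a)`. -/
def freeNegEquiv (e : ∀ X Y, P X Y ≃ P' X Y) (X Y : O) :
    (Str P X Y →₀ K) ≃ₗ[K] (Str P' X Y →₀ K) :=
  (Finsupp.domLCongr (Str.mapEquiv e X Y)).trans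
    (LinearEquiv.ofInvolutive _ (linearCombination_neg_one_pow_len_involutive X Y))

theorem Str.len_map (e : ∀ X Y, P X Y → P' X Y) {X Y : O} (p : Str P X Y) :
    (p.map e).len = p.len := by
  induction p with
  | nil => rfl
  | cons p a ih => simp only [map, len, ih]

theorem Str.deg_map (e : ∀ X Y, P X Y → P' X Y)
    (he : ∀ {X Y : O} (a : P X Y), deg' (e X Y a) = deg a) {X Y : O} (p : Str P X Y) :
    (p.map e).deg deg' = p.deg deg := by
  induction p with
  | nil => rfl
  | cons p a ih =>
    change (p.map e).deg deg' + deg' (e _ _ a) = p.deg deg + deg a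
    rw [ih, he]

theorem freeNegEquiv_single (e : ∀ X Y, P X Y ≃ P' X Y) {X Y : O} (p : Str P X Y) (c : K) :
    freeNegEquiv e X Y (Finsupp.single p c) =
      Finsupp.single (p.map fun X Y => e X Y) (c * (-1) ^ p.len) := by
  simp only [freeNegEquiv, LinearEquiv.trans_apply, Finsupp.domLCongr_single]
  rw [LinearEquiv.coe_ofInvolutive, Finsupp.linearCombination_single]
  change c • (-1 : K) ^ (p.map _).len • Finsupp.single (p.map _) (1 : K) = _
  rw [Str.len_map]
  simp

theorem freeNegEquiv_comp (e : ∀ X Y, P X Y ≃ P' X Y) {X Y Z : O} (y : Str P Y Z →₀ K)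
    (x : Str P X Y →₀ K) : freeNegEquiv e X Z (freeComp y x) =
      freeComp (freeNegEquiv e Y Z y) (freeNegEquiv e X Y x) := by
  induction y using Finsupp.induction_linear with
  | zero => simp
  | add f g hf hg => simp [hf, hg]
  | single t b =>
    induction x using Finsupp.induction_linear with
    | zero => simp
    | add f g hf hg => simp [hf, hg]
    | single u a =>
      rw [freeComp_single_single, freeNegEquiv_single, freeNegEquiv_single, freeNegEquiv_single,
        freeComp_single_single, Str.map_append, Str.len_append, pow_add]
      congr 1; ring

/-- Both sides satisfy the same Leibniz rule along the multiplicative map `freeNegEquiv e`, so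
agreement on generators suffices. The minus sign in `hd` is there because `a` is sent to `-(e a)`.
-/
theorem freeNegEquiv_freeD (e : ∀ X Y, P X Y ≃ P' X Y)
    (he : ∀ {X Y : O} (a : P X Y), deg' (e X Y a) = deg a)
    (hd : ∀ {X Y : O} (a : P X Y), freeNegEquiv e X Y (dgen a) = - dgen' (e X Y a))
    {X Y : O} (y : Str P X Y →₀ K) :
    freeNegEquiv e X Y (freeD deg dgen y) = freeD deg' dgen' (freeNegEquiv e X Y y) := by
  induction y using Finsupp.induction_linear with
  | zero => simp
  | add f g hf hg => simp only [map_add, hf, hg]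
  | single t b =>
    have : Finsupp.single t b = b • Finsupp.single t (1 : K) := by simp
    rw [this]
    simp only [map_smul]
    congr 1
    clear this
    induction t with
    | nil => rw [freeD_nil, freeNegEquiv_single]; simp [Str.map, freeDStr]
    | cons t a ih =>
      have h1 : freeNegEquiv e _ _ (Finsupp.single (Str.one a) (1 : K)) =
          -Finsupp.single (Str.one (e _ _ a)) 1 := by
        rw [freeNegEquiv_single]; simp [Str.one, Str.map, Str.len]
      rw [single_cons, freeD_comp_one, map_add, map_smul, freeNegEquiv_comp, freeNegEquiv_comp,
        freeNegEquiv_comp, ih, hd, h1, map_neg, map_neg, LinearMap.neg_apply,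
        LinearMap.neg_apply, LinearMap.neg_apply, map_neg, freeD_comp_one, he]
      module

theorem freeNegEquiv_apply_map (e : ∀ X Y, P X Y ≃ P' X Y) {X Y : O} (y : Str P X Y →₀ K)
    (t : Str P X Y) :
    freeNegEquiv e X Y y (t.map fun X Y => e X Y) = y t * (-1) ^ t.len := by
  classical
  induction y using Finsupp.induction_linear with
  | zero => simp
  | add f g hf hg => rw [map_add, Finsupp.add_apply, hf, hg, Finsupp.add_apply]; ring
  | single u b =>
    rw [freeNegEquiv_single]
    by_cases h : u = t
    · subst h; rw [Finsupp.single_eq_same, Finsupp.single_eq_same]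
    · have h' : ¬ (u.map fun X Y => e X Y) = t.map fun X Y => e X Y := fun h' =>
        h ((Str.mapEquiv e X Y).injective h')
      rw [Finsupp.single_apply, Finsupp.single_apply, if_neg h', if_neg h, zero_mul]

theorem freeNegEquiv_mem_iff (e : ∀ X Y, P X Y ≃ P' X Y)
    (he : ∀ {X Y : O} (a : P X Y), deg' (e X Y a) = deg a) {X Y : O} {i : ℤ}
    (y : Str P X Y →₀ K) :
    freeNegEquiv e X Y y ∈ Finsupp.supported K K {p : Str P' X Y | p.deg deg' = i} ↔
      y ∈ Finsupp.supported K K {p : Str P X Y | p.deg deg = i} := by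
  rw [Finsupp.mem_supported', Finsupp.mem_supported']
  constructor
  · intro h t ht
    have := h (t.map fun X Y => e X Y) (by
      rw [Set.mem_ofPred_eq, Str.deg_map (deg := deg) _ he]; exact ht)
    rw [freeNegEquiv_apply_map] at this
    exact (mul_eq_zero.1 this).resolve_right (pow_ne_zero _ (by simp))
  · intro h t ht
    obtain ⟨t, rfl⟩ := (Str.mapEquiv e X Y).surjective t
    refine (freeNegEquiv_apply_map e y t).trans ?_
    rw [h t, zero_mul]
    intro h'
    exact ht ((Str.deg_map (deg := deg) _ he t).trans h')

/-- An isomorphism of the graded quivers of generators induces an isomorphism of free DG-categories,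
with sign `-1` on the generators, if it is compatible with the differentials. -/
def freeNegIso (e : ∀ X Y, P X Y ≃ P' X Y)
    (he : ∀ {X Y : O} (a : P X Y), deg' (e X Y a) = deg a)
    (hd : ∀ {X Y : O} (a : P X Y), freeNegEquiv e X Y (dgen a) = - dgen' (e X Y a)) :
    DGIso (freeDG P deg dgen) (freeDG P' deg' dgen') where
  toEquiv := freeNegEquiv e
  map_id X := (freeNegEquiv_single e (Str.nil X) (1 : K)).trans (by
    simp only [Str.len, pow_zero, mul_one]; rfl)
  map_comp := freeNegEquiv_comp e
  map_d := freeNegEquiv_freeD e he hd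
  map_gr := freeNegEquiv_mem_iff e he

end Free

/-! ### Transport along isomorphisms of DG-categories -/

section Transport

variable {K : Type u} [Field K] {O : Type} {D E : DGCat K O}

/-- The inverse of an isomorphism of DG-categories. -/
def DGIso.symm (φ : DGIso D E) : DGIso E D where
  toEquiv X Y := (φ.toEquiv X Y).symm
  map_id X := by rw [LinearEquiv.symm_apply_eq, φ.map_id]
  map_comp a₂ a₁ := by
    rw [LinearEquiv.symm_apply_eq, φ.map_comp, LinearEquiv.apply_symm_apply,
      LinearEquiv.apply_symm_apply]
  map_d a := by rw [LinearEquiv.symm_apply_eq, φ.map_d, LinearEquiv.apply_symm_apply]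
  map_gr a := by rw [← φ.map_gr, LinearEquiv.apply_symm_apply]

/-- Each axiom is pulled back along the inverse. This yields the axioms for the cobar construction
from those of `I_n`, without a separate computation with the curvature. -/
theorem DGIso.isDG (φ : DGIso D E) (hD : D.IsDG) : E.IsDG where
  internal X Y := by
    have hgr : ∀ i, E.gr X Y i = (D.gr X Y i).map (φ.toEquiv X Y : D.Hom X Y →ₗ[K] E.Hom X Y) := by
      intro i
      ext y
      rw [Submodule.mem_map]
      constructor
      · intro hy
        exact ⟨_, (φ.symm.map_gr y).2 hy, LinearEquiv.apply_symm_apply _ _⟩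
      · rintro ⟨x, hx, rfl⟩
        exact (φ.map_gr x).2 hx
    have h := hD.internal X Y
    rw [DirectSum.isInternal_submodule_iff_iSupIndep_and_iSup_eq_top] at h ⊢
    have hE : E.gr X Y = fun i => (D.gr X Y i).map (φ.toEquiv X Y : D.Hom X Y →ₗ[K] E.Hom X Y) :=
      funext hgr
    rw [hE]
    refine ⟨?_, ?_⟩
    · exact h.1.map_orderIso (Submodule.orderIsoMapComap (φ.toEquiv X Y))
    · rw [← Submodule.map_iSup, h.2, Submodule.map_top, LinearEquiv.range]
  id_comp a := φ.symm.toEquiv _ _ |>.injective (by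
    rw [φ.symm.map_comp, φ.symm.map_id, hD.id_comp])
  comp_id a := φ.symm.toEquiv _ _ |>.injective (by
    rw [φ.symm.map_comp, φ.symm.map_id, hD.comp_id])
  assoc a₃ a₂ a₁ := φ.symm.toEquiv _ _ |>.injective (by simp only [φ.symm.map_comp, hD.assoc])
  id_mem X := by rw [← φ.map_id, φ.map_gr]; exact hD.id_mem X
  comp_mem h₂ h₁ := by
    rw [← φ.symm.map_gr] at h₂ h₁ ⊢
    rw [φ.symm.map_comp]
    exact hD.comp_mem h₂ h₁
  d_mem h := by
    rw [← φ.symm.map_gr] at h ⊢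
    rw [φ.symm.map_d]
    exact hD.d_mem h
  d_d a := φ.symm.toEquiv _ _ |>.injective (by
    rw [φ.symm.map_d, φ.symm.map_d, hD.d_d, map_zero])
  leibniz a₁ h₂ := φ.symm.toEquiv _ _ |>.injective (by
    rw [← φ.symm.map_gr] at h₂
    simp only [φ.symm.map_comp, φ.symm.map_d, map_add, map_smul, hD.leibniz _ h₂])

end Transport

/-! ### Signs -/

section Signs

variable {K : Type u} [Field K]

/-- All sign comparisons below go through this reduction to parities, which `omega` decides. -/
theorem neg_one_zpow_congr {a b : ℤ} (h : a % 2 = b % 2) : (-1 : K) ^ a = (-1) ^ b := by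
  have h1 : Even (a - b) := by rw [Int.even_iff]; omega
  have h2 : a = b + (a - b) := by ring
  rw [h2, zpow_add₀ (by simp), h1.neg_one_zpow, mul_one]

theorem neg_one_zpow_neg {a b : ℤ} (h : a % 2 ≠ b % 2) : (-1 : K) ^ a = -(-1) ^ b := by
  rw [neg_one_zpow_congr (show a % 2 = (b + 1) % 2 by omega), zpow_add₀ (by simp)]
  simp

theorem neg_one_zpow_mul (a b : ℤ) : (-1 : K) ^ a * (-1) ^ b = (-1) ^ (a + b) :=
  (zpow_add₀ (by simp) _ _).symm

theorem neg_one_zpow_eq_one {a : ℤ} (h : a % 2 = 0) : (-1 : K) ^ a = 1 := by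
  rw [neg_one_zpow_congr (b := 0) (by simpa using h), zpow_zero]

theorem neg_one_zpow_eq_neg_one {a : ℤ} (h : a % 2 = 1) : (-1 : K) ^ a = -1 := by
  rw [neg_one_zpow_neg (b := 0) (by simp [h]), zpow_zero]

end Signs

/-! ### Winding numbers -/

section Winding

variable {n : ℕ}

theorem winding_one_cases {s : ℕ} {r j : Fin n} (h : (s : ℤ) * n + (j : ℕ) - (r : ℕ) = 1) :
    (s = 0 ∧ (j : ℕ) = r + 1) ∨ (s = 1 ∧ (j : ℕ) = 0 ∧ (r : ℕ) + 1 = n) := by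
  have hr := r.2
  have hj := j.2
  rcases s with _ | _ | s
  · left; simp at h; omega
  · right; simp at h; omega
  · exfalso
    push_cast at h
    have : (s : ℤ) * n ≥ 0 := by positivity
    have h2 : ((s : ℤ) + 1 + 1) * n = s * n + 2 * n := by ring
    omega

theorem sum_range_sum_fin_ite_eq {M : Type*} [AddCommMonoid M] (G : ℕ → Fin n → M) (p : ℕ)
    (r : Fin n) :
    ∑ q ∈ Finset.range (p + 1), ∑ t, (if q = p ∧ t = r then G q t else 0) = G p r := by
  rw [Finset.sum_eq_single p, Finset.sum_eq_single r]
  · simp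
  · intro t _ ht; simp [ht]
  · simp
  · intro q _ hq; simp [hq]
  · simp

/-- Splittings of an arrow of winding number `s + p` that ends with an arrow of length one. -/
theorem sum_splittings_succ {M : Type*} [AddCommMonoid M] (G : ℕ → Fin n → M) {s p : ℕ}
    {r j : Fin n} (h : (s : ℤ) * n + (j : ℕ) - (r : ℕ) = 1) :
    ∑ q ∈ Finset.range (s + p + 1), ∑ t : Fin n,
        (if 1 ≤ s + p - q ∨ t < j then G q t else 0) =
      G p r + ∑ q ∈ Finset.range (p + 1), ∑ t : Fin n,
        (if 1 ≤ p - q ∨ t < r then G q t else 0) := by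
  rw [← sum_range_sum_fin_ite_eq G p r, ← Finset.sum_add_distrib]
  simp_rw [← Finset.sum_add_distrib]
  -- A left factor ending at `j` is either the length-one arrow `r → j` itself, when `(q, t) = (p,
  -- r)`, or that arrow after a non-empty path `t → r`. The arrow either joins neighbours or closes
  -- the circle.
  rcases winding_one_cases h with ⟨rfl, hj⟩ | ⟨rfl, hj, hr⟩
  · rw [Nat.zero_add]
    refine Finset.sum_congr rfl fun q hq => Finset.sum_congr rfl fun t _ => ?_
    rw [Finset.mem_range] at hq
    by_cases h1 : 1 ≤ p - q
    · have : q ≠ p := by omega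
      simp [h1, this]
    · have : q = p := by omega
      subst this
      rcases lt_trichotomy t r with h2 | h2 | h2
      · have : t < j := by rw [Fin.lt_def] at *; omega
        simp [this, h2, h2.ne]
      · have : t < j := by subst h2; rw [Fin.lt_def] at *; omega
        subst h2; simp [this]
      · have : ¬ t < j := by rw [Fin.lt_def] at *; omega
        simp [this, h2.ne', not_lt.2 h2.le]
  · rw [show 1 + p + 1 = (p + 1) + 1 by ring, Finset.sum_range_succ]
    have hlt : ∀ t : Fin n, ¬ t < j := by intro t; rw [Fin.lt_def]; omega
    -- At `q = p + 1` the left factor would have winding number `0` and end at the first object,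
    -- which no non-empty path does.
    have h0 : ∑ t : Fin n, (if 1 ≤ 1 + p - (p + 1) ∨ t < j then G (p + 1) t else 0) = 0 := by
      refine Finset.sum_eq_zero fun t _ => ?_
      rw [if_neg]
      rintro (h' | h')
      · omega
      · exact hlt t h'
    rw [h0, add_zero]
    refine Finset.sum_congr rfl fun q hq => Finset.sum_congr rfl fun t _ => ?_
    rw [Finset.mem_range] at hq
    rw [if_pos (Or.inl (by omega))]
    by_cases h1 : 1 ≤ p - q
    · have : q ≠ p := by omega
      simp [h1, this]
    · have : q = p := by omega
      subst this
      have ht := t.2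
      by_cases h2 : t = r
      · subst h2; simp
      · have : t < r := by
          rw [Fin.lt_def]
          have : (t : ℕ) ≠ r := fun h' => h2 (Fin.ext h')
          omega
        simp [this, h2]

variable [NeZero n]

/-- The number of times an arrow passes from the last object to the first one. -/
def XGen.wrap : ∀ {i j : Fin n}, XGen n i j → ℕ
  | _, _, .x i => if (i : ℕ) + 1 = n then 1 else 0

/-- On the universal cover of the circle, where a passage from the last object to the first adds
`n`, every `x_i` is a step of length one. -/
theorem XGen.wrap_spec {i j : Fin n} (a : XGen n i j) :
    (a.wrap : ℤ) * n + (j : ℕ) - (i : ℕ) = 1 := by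
  obtain ⟨i⟩ := a
  have hi := i.2
  simp only [wrap]
  split_ifs with h
  · have : i + 1 = 0 := by
      apply Fin.ext
      rw [Fin.val_add, Fin.val_zero, Fin.val_one', Nat.add_mod_mod, h, Nat.mod_self]
    rw [this]; simp; omega
  · have : ((i + 1 : Fin n) : ℕ) = i + 1 := by
      rw [Fin.val_add, Fin.val_one', Nat.add_mod_mod, Nat.mod_eq_of_lt (by omega)]
    rw [this]; simp

theorem XGen.deg_eq (m : Fin n → ℤ) {i j : Fin n} (a : XGen n i j) :
    XGen.deg m a = 1 - 2 * (a.wrap : ℤ) + m j - m i := by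
  obtain ⟨i⟩ := a
  simp only [wrap, deg]
  split_ifs <;> push_cast <;> ring

/-- An arrow is determined by its source; heterogeneous equality is needed because the target is not
fixed in advance. -/
theorem XGen.heq {i j j' : Fin n} (a : XGen n i j) (b : XGen n i j') : HEq a b := by
  cases a
  cases b
  rfl

instance XGen.subsingleton (i j : Fin n) : Subsingleton (XGen n i j) :=
  ⟨fun a b => eq_of_heq (a.heq b)⟩

/-! ### Paths on the circle: length, shifted degree and winding number -/

namespace Str

/-- The number of times a string passes from the last object to the first one. -/
def wrap {i j : Fin n} : Str (XGen n) i j → ℕ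
  | nil _ => 0
  | cons p a => wrap p + a.wrap

/-- The identities `XGen.wrap_spec` of the single steps telescope along the path. -/
theorem len_eq_wrap {i j : Fin n} (p : Str (XGen n) i j) :
    (p.len : ℤ) = (p.wrap : ℤ) * n + (j : ℕ) - (i : ℕ) := by
  induction p with
  | nil => simp [len, wrap]
  | cons p a ih =>
    have := a.wrap_spec
    simp only [len, wrap]
    push_cast
    linarith

theorem sdeg_eq_wrap (m : Fin n → ℤ) {i j : Fin n} (p : Str (XGen n) i j) :
    p.sdeg (XGen.deg m) = -2 * (p.wrap : ℤ) + m j - m i := by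
  induction p with
  | nil => simp [sdeg, deg, len, wrap]
  | cons p a ih =>
    have h := a.deg_eq m
    simp only [sdeg, deg, len, wrap] at ih ⊢
    push_cast
    linarith

theorem wrap_valid {i j : Fin n} (p : Str (XGen n) i j) (hp : p.len ≠ 0) :
    1 ≤ p.wrap ∨ i < j := by
  have h := p.len_eq_wrap
  rcases Nat.eq_zero_or_pos p.wrap with h0 | h0
  · right
    rw [h0] at h
    rw [Fin.lt_def]
    simp at h
    omega
  · exact Or.inl h0

theorem wrap_of_len_eq_zero {i j : Fin n} (p : Str (XGen n) i j) (hp : p.len = 0) :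
    p.wrap = 0 := by
  cases p with
  | nil => rfl
  | cons p a => simp [len] at hp

theorem eq_of_len_eq_zero {O : Type} {Q : O → O → Type} {i j : O} (p : Str Q i j)
    (hp : p.len = 0) : i = j := by
  cases p with
  | nil => rfl
  | cons p a => simp [len] at hp

theorem not_valid_of_len_eq_zero {i j : Fin n} (p : Str (XGen n) i j) (hp : p.len = 0) :
    ¬ (1 ≤ p.wrap ∨ i < j) := by
  rw [p.wrap_of_len_eq_zero hp, p.eq_of_len_eq_zero hp]
  simp

/-- Each object has exactly one outgoing arrow. Since the strings are built from the source end, the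
induction removes last arrows, and injectivity of adding one identifies the targets of the shortened
strings. -/
theorem heq_of_len_eq {i j j' : Fin n} (p : Str (XGen n) i j) (p' : Str (XGen n) i j')
    (hj : j = j') (h : p.len = p'.len) : HEq p p' := by
  induction p generalizing j' with
  | nil =>
    cases p' with
    | nil => rfl
    | cons p' a => simp [len] at h
  | cons p a ih =>
    cases p' with
    | nil => simp [len] at h
    | cons p' b =>
      cases a
      cases b
      obtain rfl := add_right_cancel hj
      have := eq_of_heq (ih p' rfl (by simpa [len] using h))
      rw [this]

theorem eq_of_len_eq {i j : Fin n} (p p' : Str (XGen n) i j) (h : p.len = p'.len) : p = p' :=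
  eq_of_heq (heq_of_len_eq p p' rfl h)

theorem exists_len_eq (i : Fin n) (l : ℕ) : ∃ (j : Fin n) (p : Str (XGen n) i j), p.len = l := by
  induction l with
  | zero => exact ⟨i, nil i, rfl⟩
  | succ l ih =>
    obtain ⟨j, p, rfl⟩ := ih
    exact ⟨_, p.cons (.x j), rfl⟩

end Str

/-- Non-empty strings of the arrows `x_i` correspond to the generators of the internal
DG-category. -/
def strEquivCGen (i j : Fin n) : {p : Str (XGen n) i j // p.len ≠ 0} ≃ CGen n i j :=
  Equiv.ofBijective (fun p => ⟨p.1.wrap, p.1.wrap_valid p.2⟩) (by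
    constructor
    · rintro ⟨p, hp⟩ ⟨p', hp'⟩ h
      have h : p.wrap = p'.wrap := congrArg Subtype.val h
      have h1 := p.len_eq_wrap
      have h2 := p'.len_eq_wrap
      rw [h] at h1
      exact Subtype.ext (Str.eq_of_len_eq p p' (by omega))
    · rintro ⟨w, hw⟩
      have hi := i.2
      have hj := j.2
      have hpos : (i : ℕ) < w * n + j := by
        rcases hw with hw | hw
        · have : 1 * n ≤ w * n := Nat.mul_le_mul_right n hw
          omega
        · have := Fin.lt_def.1 hw
          omega
      -- The preimage of winding number `w` is the path of length `w * n + j - i` from `i`;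
      -- reduction modulo `n` shows that it ends at `j`, and then its winding number must be `w`.
      obtain ⟨j', p, hp⟩ := Str.exists_len_eq i (w * n + j - i)
      have h1 := p.len_eq_wrap
      rw [hp, Nat.cast_sub hpos.le] at h1
      have h2 : w * n + j = p.wrap * n + j' := by
        have : ((w * n + j : ℕ) : ℤ) = ((p.wrap * n + j' : ℕ) : ℤ) := by push_cast at h1 ⊢; linarith
        exact_mod_cast this
      have hj' := j'.2
      have h3 : j = j' := by
        apply Fin.ext
        have := congrArg (· % n) h2
        simpa [Nat.mul_add_mod', Nat.mod_eq_of_lt hj, Nat.mod_eq_of_lt hj'] using this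
      subst h3
      have h4 : w = p.wrap := by
        have : w * n = p.wrap * n := by omega
        exact Nat.eq_of_mul_eq_mul_right (by omega) this
      exact ⟨⟨p, by omega⟩, Subtype.ext h4.symm⟩)

/-- The decompositions of a string of the arrows `x_i` in terms of winding numbers. -/
theorem sum_splits_eq {M : Type*} [AddCommMonoid M] {i j : Fin n} (p : Str (XGen n) i j)
    (G : ℕ → Fin n → M) (hG : ∀ q t, ¬ (1 ≤ q ∨ i < t) → G q t = 0) :
    (p.splits.map fun s => if s.2.2.len = 0 then 0 else G s.2.1.wrap s.1).sum =
      ∑ q ∈ Finset.range (p.wrap + 1), ∑ t : Fin n,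
        (if 1 ≤ p.wrap - q ∨ t < j then G q t else 0) := by
  induction p with
  | nil =>
    symm
    simp only [Str.wrap, Str.splits, Str.len, Finset.range_one, zero_add, Finset.sum_singleton,
      List.map_cons, List.map_nil, List.sum_cons, List.sum_nil, if_true]
    -- For the empty path only `q = 0` remains and `t < j = i` is required, so `(0, t)` is not a
    -- valid index for the right factor and `G` vanishes by `hG`.
    refine Finset.sum_eq_zero fun t _ => ?_
    refine ite_eq_right_iff.2 fun h => hG 0 t ?_
    rw [Fin.lt_def] at *
    omega
  | cons p a ih =>
    have hw : (p.cons a).wrap = a.wrap + p.wrap := by simp only [Str.wrap, add_comm]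
    rw [hw, sum_splittings_succ G a.wrap_spec, ← ih]
    simp only [Str.splits, List.map_cons, List.sum_cons, Str.len, if_true, zero_add, List.map_map]
    -- The splittings of `p.cons a` with non-empty second part correspond to all splittings of `p`.
    -- Separating the one with empty second part gives the extra term of `sum_splittings_succ`.
    have hS : ∀ {i j : Fin n} (p : Str (XGen n) i j) (G : ℕ → Fin n → M),
        (p.splits.map fun s => G s.2.1.wrap s.1).sum = G p.wrap j +
          (p.splits.map fun s => if s.2.2.len = 0 then 0 else G s.2.1.wrap s.1).sum := by
      intro i j p G
      cases p with
      | nil => simp [Str.splits, Str.len, Str.wrap]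
      | cons p a =>
        simp [Str.splits, Str.len, Function.comp_def]
    rw [← hS]
    simp [Function.comp_def, Str.len]

end Winding

/-! ### The internal DG-category satisfies the axioms -/

section Internal

open Finset (range)

/-- Both sides run over the triples with sum `p`, with `d = q + q'`. This compares the two
bracketings of the cubic terms in `∂∂c^p`. -/
theorem sum_range_sum_range_triple {M : Type*} [AddCommMonoid M] (f : ℕ → ℕ → ℕ → M) (p : ℕ) :
    ∑ q ∈ range (p + 1), ∑ q' ∈ range (p - q + 1), f q q' (p - q - q') =
      ∑ d ∈ range (p + 1), ∑ a ∈ range (d + 1), f a (d - a) (p - d) := by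
  rw [Finset.sum_sigma', Finset.sum_sigma']
  refine Finset.sum_nbij' (fun x => ⟨x.1 + x.2, x.1⟩) (fun x => ⟨x.2, x.1 - x.2⟩) ?_ ?_ ?_ ?_ ?_
  · rintro ⟨q, q'⟩ h
    simp only [Finset.mem_sigma, Finset.mem_range] at h ⊢
    omega
  · rintro ⟨d, a⟩ h
    simp only [Finset.mem_sigma, Finset.mem_range] at h ⊢
    omega
  · rintro ⟨q, q'⟩ h
    simp
  · rintro ⟨d, a⟩ h
    simp only [Finset.mem_sigma, Finset.mem_range] at h
    simp only [Sigma.mk.injEq, heq_eq_eq, and_true]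
    omega
  · rintro ⟨q, q'⟩ h
    simp [Nat.sub_sub]

variable (K : Type u) [Field K] {n : ℕ} (m : Fin n → ℤ)

/-- The degree of `c^p_{ij}`. -/
abbrev cDeg {i j : Fin n} (p : CGen n i j) : ℤ := 1 - 2 * (p.1 : ℤ) + m j - m i

/-- The right-hand side of the formula for `∂ c^p_{ij}`, for all `p`, `i`, `j`. -/
def cDiff (p : ℕ) (i j : Fin n) : Str (CGen n) i j →₀ K :=
  (if p = 1 then freeDelta i j else 0) +
    ∑ q ∈ range (p + 1), ∑ r : Fin n,
      (-1 : K) ^ (m r + m j) • freeComp (cElt K (p - q) r j) (cElt K q i r)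

/-- The differential of the internal DG-category. -/
abbrev cD {i j : Fin n} : (Str (CGen n) i j →₀ K) →ₗ[K] (Str (CGen n) i j →₀ K) :=
  freeD (P := CGen n) (fun {_ _} p => cDeg m p) (fun {_ _} p => cDiff K m p.1 _ _)

theorem internalDG_eq : internalDG K n m =
    freeDG (CGen n) (fun {_ _} p => cDeg m p) (fun {_ _} p => cDiff K m p.1 _ _) := rfl

theorem cElt_of_valid {p : ℕ} {i j : Fin n} (h : 1 ≤ p ∨ i < j) :
    cElt K p i j = Finsupp.single (Str.one (⟨p, h⟩ : CGen n i j)) 1 := dif_pos h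

theorem cElt_of_not_valid {p : ℕ} {i j : Fin n} (h : ¬ (1 ≤ p ∨ i < j)) : cElt K p i j = 0 :=
  dif_neg h

theorem cElt_mem (p : ℕ) (i j : Fin n) : cElt K p i j ∈
    Finsupp.supported K K {w : Str (CGen n) i j |
      w.deg (fun {_ _} p => cDeg m p) = 1 - 2 * (p : ℤ) + m j - m i} := by
  by_cases h : 1 ≤ p ∨ i < j
  · rw [cElt_of_valid K h]
    refine Finsupp.single_mem_supported _ _ ?_
    simp [Str.one, Str.deg]
  · rw [cElt_of_not_valid K h]
    exact zero_mem _

theorem freeDelta_self {O : Type} {P : O → O → Type} [DecidableEq O] (X : O) :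
    (freeDelta X X : Str P X X →₀ K) = Finsupp.single (Str.nil X) 1 := by
  simp [freeDelta, Str.ofEq]

theorem freeDelta_of_ne {O : Type} {P : O → O → Type} [DecidableEq O] {X Y : O} (h : X ≠ Y) :
    (freeDelta X Y : Str P X Y →₀ K) = 0 := by
  simp [freeDelta, h]

theorem cDiff_mem (p : ℕ) (i j : Fin n) : cDiff K m p i j ∈
    Finsupp.supported K K {w : Str (CGen n) i j |
      w.deg (fun {_ _} p => cDeg m p) = 1 - 2 * (p : ℤ) + m j - m i + 1} := by
  refine add_mem ?_ (sum_mem fun q hq => sum_mem fun r _ => Submodule.smul_mem _ _ ?_)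
  · split_ifs with hp
    · by_cases hij : i = j
      · subst hij hp
        rw [freeDelta_self]
        refine Finsupp.single_mem_supported _ _ ?_
        simp [Str.deg]
      · rw [freeDelta_of_ne K hij]; exact zero_mem _
    · exact zero_mem _
  · have hq' : q ≤ p := by rw [Finset.mem_range] at hq; omega
    have := freeComp_mem (fun {X Y Z} u t => by rw [Str.deg_append, add_comm])
      (cElt_mem K m (p - q) r j) (cElt_mem K m q i r)
    rw [Nat.cast_sub hq'] at this
    convert this using 4
    ring_nf

theorem cD_freeDelta (i j : Fin n) : cD K m (freeDelta i j) = 0 := by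
  by_cases hij : i = j
  · subst hij
    rw [freeDelta_self, freeD_nil]
  · rw [freeDelta_of_ne K hij, map_zero]

/-- The formula for `∂` stays correct under the convention `c^0_{ij} = 0` for `i ≥ j`: a non-zero
quadratic term would need `i < r < j`. Hence `∂∂` can be computed without distinguishing which
generators exist. -/
theorem cD_cElt (p : ℕ) (i j : Fin n) : cD K m (cElt K p i j) = cDiff K m p i j := by
  by_cases h : 1 ≤ p ∨ i < j
  · rw [cElt_of_valid K h, freeD_one]
  · rw [cElt_of_not_valid K h, map_zero]
    have hp : p = 0 := by omega
    subst hp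
    simp only [cDiff, Finset.range_one, Finset.sum_singleton, zero_add, zero_ne_one, if_false,
      Nat.sub_self]
    refine (Finset.sum_eq_zero fun r _ => ?_).symm
    by_cases h1 : i < r
    · have h2 : ¬ (1 ≤ 0 ∨ r < j) := by
        rintro (h2 | h2)
        · omega
        · exact h (Or.inr (h1.trans h2))
      rw [cElt_of_not_valid K h2, map_zero, LinearMap.zero_apply, smul_zero]
    · rw [cElt_of_not_valid K (p := 0) (i := i) (j := r) (by omega), map_zero, smul_zero]

theorem cD_comp_cElt (p q : ℕ) (i r j : Fin n) :
    cD K m (freeComp (cElt K p r j) (cElt K q i r)) =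
      freeComp (cDiff K m p r j) (cElt K q i r) -
        (-1 : K) ^ (m r + m j) • freeComp (cElt K p r j) (cDiff K m q i r) := by
  rw [freeD_comp _ (cElt_mem K m p r j), cD_cElt, cD_cElt,
    neg_one_zpow_neg (b := m r + m j) (by omega), neg_smul, sub_eq_add_neg]

/-- The part of `∂ ∂ c^p_{ij}` which comes from the constant term in the differential of the left
factor. -/
theorem sum_delta_comp (p : ℕ) (i j : Fin n) :
    ∑ q ∈ range (p + 1), ∑ r : Fin n, (-1 : K) ^ (m r + m j) •
      freeComp (if p - q = 1 then freeDelta r j else 0) (cElt K q i r) =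
    if 1 ≤ p then cElt K (p - 1) i j else 0 := by
  have h1 : ∀ q, ∑ r : Fin n, (-1 : K) ^ (m r + m j) •
      freeComp (if p - q = 1 then freeDelta r j else 0) (cElt K q i r) =
      if p - q = 1 then cElt K q i j else 0 := by
    intro q
    rw [Finset.sum_eq_single j]
    · rw [neg_one_zpow_eq_one (by omega), one_smul]
      split_ifs with h
      · rw [freeDelta_self, freeComp_nil_left]
      · simp
    · intro r _ hr
      rw [freeDelta_of_ne K hr, ite_self, map_zero, LinearMap.zero_apply, smul_zero]
    · simp
  simp_rw [h1]
  split_ifs with hp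
  · rw [Finset.sum_eq_single (p - 1)]
    · rw [if_pos (by omega)]
    · intro q _ hq; rw [if_neg (by omega)]
    · intro h; rw [Finset.mem_range] at h; omega
  · exact Finset.sum_eq_zero fun q _ => if_neg (by omega)

/-- The part of `∂ ∂ c^p_{ij}` which comes from the constant term in the differential of the right
factor. -/
theorem sum_comp_delta (p : ℕ) (i j : Fin n) :
    ∑ q ∈ range (p + 1), ∑ r : Fin n,
      freeComp (cElt K (p - q) r j) (if q = 1 then freeDelta i r else 0) =
    if 1 ≤ p then cElt K (p - 1) i j else 0 := by
  have h1 : ∀ q, ∑ r : Fin n,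
      freeComp (cElt K (p - q) r j) (if q = 1 then freeDelta i r else 0) =
      if q = 1 then cElt K (p - q) i j else 0 := by
    intro q
    rw [Finset.sum_eq_single i]
    · split_ifs with h
      · rw [freeDelta_self, freeComp_nil_right]
      · simp
    · intro r _ hr
      rw [freeDelta_of_ne K hr.symm, ite_self, map_zero]
    · simp
  simp_rw [h1]
  split_ifs with hp
  · rw [Finset.sum_eq_single 1]
    · rw [if_pos rfl]
    · intro q _ hq; rw [if_neg hq]
    · intro h; rw [Finset.mem_range] at h; omega
  · refine Finset.sum_eq_zero fun q hq => if_neg ?_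
    rw [Finset.mem_range] at hq; omega

/-- The sign of a left factor is `-(-1)^(m_r + m_j)`, so differentiating left and right factors
contributes with opposite signs. The constant terms give `c^{p-1}_{ij}` once from each side, and the
cubic terms agree by associativity after reindexing. -/
theorem cD_cDiff (p : ℕ) (i j : Fin n) : cD K m (cDiff K m p i j) = 0 := by
  have hA : ∀ q r, (-1 : K) ^ (m r + m j) • freeComp (cDiff K m (p - q) r j) (cElt K q i r) =
      (-1 : K) ^ (m r + m j) •
        freeComp (if p - q = 1 then freeDelta r j else 0) (cElt K q i r) +
      ∑ q' ∈ range (p - q + 1), ∑ s : Fin n, (-1 : K) ^ (m r + m s) •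
        freeComp (cElt K (p - q - q') s j) (freeComp (cElt K q' r s) (cElt K q i r)) := by
    intro q r
    simp only [cDiff, map_add, LinearMap.add_apply, smul_add, map_sum, LinearMap.sum_apply,
      map_smul, LinearMap.smul_apply, Finset.smul_sum, smul_smul, freeComp_assoc]
    congr 1
    refine Finset.sum_congr rfl fun q' _ => Finset.sum_congr rfl fun s _ => ?_
    rw [neg_one_zpow_mul, neg_one_zpow_congr (show _ % 2 = (m r + m s) % 2 by omega)]
  have hB : ∀ q r, freeComp (cElt K (p - q) r j) (cDiff K m q i r) =
      freeComp (cElt K (p - q) r j) (if q = 1 then freeDelta i r else 0) +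
      ∑ q' ∈ range (q + 1), ∑ s : Fin n, (-1 : K) ^ (m s + m r) •
        freeComp (cElt K (p - q) r j) (freeComp (cElt K (q - q') s r) (cElt K q' i s)) := by
    intro q r
    simp only [cDiff, map_add, map_sum, map_smul]
  have hsq : ∀ r, (-1 : K) ^ (m r + m j) * (-1) ^ (m r + m j) = 1 := fun r => by
    rw [neg_one_zpow_mul, neg_one_zpow_eq_one (by omega)]
  rw [cDiff, map_add]
  have h0 : cD K m (if p = 1 then freeDelta i j else 0) = 0 := by
    split_ifs
    · exact cD_freeDelta K m i j
    · exact map_zero _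
  rw [h0, zero_add]
  simp only [map_sum, map_smul, cD_comp_cElt, smul_sub, smul_smul, hsq, one_smul, hA, hB,
    Finset.sum_sub_distrib, Finset.sum_add_distrib]
  rw [sum_delta_comp, sum_comp_delta, sub_eq_zero]
  congr 1
  simp only [Finset.sum_comm (s := (Finset.univ : Finset (Fin n))) (t := range _)]
  rw [sum_range_sum_range_triple fun a b c => ∑ r : Fin n, ∑ s : Fin n, (-1 : K) ^ (m r + m s) •
        freeComp (cElt K c s j) (freeComp (cElt K b r s) (cElt K a i r))]
  exact Finset.sum_congr rfl fun d _ => Finset.sum_congr rfl fun a _ => Finset.sum_comm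

theorem internalDG_isDG : (internalDG K n m).IsDG := by
  rw [internalDG_eq]
  exact freeDG_isDG (fun a => cDiff_mem K m _ _ _) (fun a => cD_cDiff K m _ _ _)

end Internal

/-! ### The cobar-bar construction of Kontsevich's category -/

section CobarBar

variable (K : Type u) [Field K] {n : ℕ} [NeZero n] (m : Fin n → ℤ)

theorem genPart_single_ofEq {O : Type} {Q : O → O → Type} {X Y : O} (h : X = Y) (c : K) :
    genPart (Q := Q) (Finsupp.single (UBasis.ofEq h) c) = 0 := by
  subst h
  ext a
  simp [genPart, UBasis.ofEq]

theorem kontsevich_m_of_eq {i j : Fin n} (p : Str (XGen n) i j) (h : p.len = n) (hij : i = j) :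
    (kontsevich K n m).m p = Finsupp.single (UBasis.ofEq hij) 1 := dif_pos ⟨h, hij⟩

theorem kontsevich_m_of_ne {i j : Fin n} (p : Str (XGen n) i j) (h : p.len ≠ n) :
    (kontsevich K n m).m p = 0 := dif_neg fun h' => h h'.1

theorem eq_of_len_eq_card {i j : Fin n} (p : Str (XGen n) i j) (h : p.len = n) : i = j := by
  have h1 := p.len_eq_wrap
  rw [h] at h1
  have h2 : n + i = p.wrap * n + j := by
    have : ((n + i : ℕ) : ℤ) = ((p.wrap * n + j : ℕ) : ℤ) := by push_cast; linarith
    exact_mod_cast this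
  have h3 := congrArg (· % n) h2
  apply Fin.ext
  simpa [Nat.mul_add_mod', Nat.mod_eq_of_lt i.2, Nat.mod_eq_of_lt j.2] using h3

/-- This matches the strings on which `𝔪_n` is non-zero with the factor `δ_{p1} δ_{ij}` in
`∂c^p_{ij}`. -/
theorem len_eq_card_iff {i j : Fin n} (p : Str (XGen n) i j) :
    p.len = n ↔ p.wrap = 1 ∧ i = j := by
  have hl := p.len_eq_wrap
  constructor
  · intro h
    have hij := eq_of_len_eq_card p h
    refine ⟨?_, hij⟩
    subst hij
    rw [h] at hl
    have h2 : 1 * n = p.wrap * n := by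
      have : ((1 * n : ℕ) : ℤ) = ((p.wrap * n : ℕ) : ℤ) := by push_cast; linarith
      exact_mod_cast this
    exact (Nat.eq_of_mul_eq_mul_right (Nat.pos_of_ne_zero (NeZero.ne n)) h2).symm
  · rintro ⟨hw, rfl⟩
    rw [hw] at hl
    push_cast at hl
    omega

theorem genPart_kontsevich_m {i j : Fin n} (p : Str (XGen n) i j) :
    genPart ((kontsevich K n m).m p) = 0 := by
  by_cases h : p.len = n
  · rw [kontsevich_m_of_eq K m p h (eq_of_len_eq_card p h)]
    exact genPart_single_ofEq K _ 1
  · rw [kontsevich_m_of_ne K m p h]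
    ext a; simp [genPart]

/-- Operations on non-units have values in the span of the units, so they contribute to the
curvature only. -/
theorem bar_kontsevich_d {i j : Fin n} (p : (bar (kontsevich K n m)).P i j) :
    (bar (kontsevich K n m)).d p = 0 := by
  simp only [bar, Str.sum₃]
  refine smul_eq_zero_of_right _ (List.sum_eq_zero ?_)
  intro x hx
  obtain ⟨s, -, rfl⟩ := List.mem_map.1 hx
  refine List.sum_eq_zero ?_
  intro y hy
  obtain ⟨r, -, rfl⟩ := List.mem_map.1 hy
  have h := genPart_kontsevich_m K m r.2.1
  rw [h]
  simp

/-- A basis element of the bar construction as a string of the arrows `x_i`. -/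
def barStr {i j : Fin n} (p : (bar (kontsevich K n m)).P i j) : Str (XGen n) i j :=
  Subtype.val (p := fun p : Str (XGen n) i j => p.len ≠ 0) p

theorem bar_kontsevich_h_smul {i j : Fin n} (p : (bar (kontsevich K n m)).P i j) :
    (bar (kontsevich K n m)).h p • (freeDelta i j : Str (CGen n) i j →₀ K) =
      if (barStr K m p).wrap = 1 then freeDelta i j else 0 := by
  by_cases hij : i = j
  · subst hij
    change unitCoeff ((kontsevich K n m).m (barStr K m p)) • _ = _
    have hl := len_eq_card_iff (barStr K m p)
    by_cases hw : (barStr K m p).wrap = 1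
    · rw [kontsevich_m_of_eq K m (barStr K m p) (hl.2 ⟨hw, rfl⟩) rfl, if_pos hw]
      simp [unitCoeff]
    · rw [kontsevich_m_of_ne K m (barStr K m p) (fun h => hw (hl.1 h).1), if_neg hw]
      simp [unitCoeff]
  · rw [freeDelta_of_ne K hij, smul_zero, ite_self]

theorem Str.append_of_mem_splits {O : Type} {Q : O → O → Type} {X Y : O} (p : Str Q X Y)
    (s : Σ Z : O, Str Q X Z × Str Q Z Y) (hs : s ∈ p.splits) : s.2.1.append s.2.2 = p := by
  induction p with
  | nil => simp only [splits, List.mem_singleton] at hs; subst hs; rfl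
  | cons p a ih =>
    simp only [splits, List.mem_cons, List.mem_map] at hs
    rcases hs with rfl | ⟨s, hs, rfl⟩
    · rfl
    · rw [append_cons, ih s hs]

theorem Str.wrap_append {i j k : Fin n} (u : Str (XGen n) i j) (t : Str (XGen n) j k) :
    (u.append t).wrap = u.wrap + t.wrap := by
  induction t with
  | nil => rfl
  | cons t a ih => simp only [append_cons, wrap, ih]; omega

/-- Consequently splittings with an empty part may be included in quadratic sums without changing
them. -/
theorem cElt_of_len_eq_zero {i j : Fin n} (p : Str (XGen n) i j) (hp : p.len = 0) :
    cElt K p.wrap i j = 0 := cElt_of_not_valid K (p.not_valid_of_len_eq_zero hp)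

/-- The quadratic part of the differential of `I_n` in terms of decompositions of strings. -/
theorem sum_splits_cElt {i j : Fin n} (p : Str (XGen n) i j) :
    (p.splits.map fun s => (-1 : K) ^ (m s.1 + m j) •
        freeComp (cElt K s.2.2.wrap s.1 j) (cElt K s.2.1.wrap i s.1)).sum =
      ∑ q ∈ Finset.range (p.wrap + 1), ∑ r : Fin n,
        (-1 : K) ^ (m r + m j) • freeComp (cElt K (p.wrap - q) r j) (cElt K q i r) := by
  let G : ℕ → Fin n → (Str (CGen n) i j →₀ K) := fun q r =>
    (-1 : K) ^ (m r + m j) • freeComp (cElt K (p.wrap - q) r j) (cElt K q i r)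
  have hG : ∀ q r, ¬ (1 ≤ q ∨ i < r) → G q r = 0 := fun q r h => by
    simp only [G]
    rw [cElt_of_not_valid K h, map_zero, smul_zero]
  have h1 := sum_splits_eq p G hG
  have h2 : ∀ q r, (if 1 ≤ p.wrap - q ∨ r < j then G q r else 0) = G q r := by
    intro q r
    refine ite_eq_left_iff.2 fun h => ?_
    simp only [G]
    rw [cElt_of_not_valid K h, map_zero, LinearMap.zero_apply, smul_zero]
  simp only [h2] at h1
  rw [← h1]
  refine congrArg List.sum (List.map_congr_left fun s hs => ?_)
  have h3 := congrArg Str.wrap (p.append_of_mem_splits s hs)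
  rw [Str.wrap_append] at h3
  split_ifs with h4
  · rw [cElt_of_len_eq_zero K _ h4, map_zero, LinearMap.zero_apply, smul_zero]
  · simp only [G]
    rw [show s.2.2.wrap = p.wrap - s.2.1.wrap by omega]

theorem freeNegEquiv_freeDelta {O : Type} [DecidableEq O] {P P' : O → O → Type}
    (e : ∀ X Y, P X Y ≃ P' X Y) (X Y : O) :
    freeNegEquiv e X Y (freeDelta X Y : Str P X Y →₀ K) = freeDelta X Y := by
  by_cases h : X = Y
  · subst h
    rw [freeDelta_self, freeDelta_self, freeNegEquiv_single]
    simp [Str.len, Str.map]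
  · rw [freeDelta_of_ne K h, freeDelta_of_ne K h, map_zero]

/-- The differential of a generator of the cobar construction. -/
def cobarDiff {O : Type} [DecidableEq O] (C : CurvedCocat K O) {X Y : O} (c : C.P X Y) :
    Str C.P X Y →₀ K :=
  - (C.h c • freeDelta X Y) - Finsupp.mapDomain Str.one (C.d c) -
    Finsupp.linearCombination K (fun s : Σ Z : O, C.P X Z × C.P Z Y => (-1 : K) ^ C.deg s.2.2 •
      Finsupp.single (((Str.nil X).cons s.2.1).cons s.2.2) (1 : K)) (C.Δ c)

/-- Writing the coproduct term as a linear combination makes it accessible to linear maps. -/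
theorem cobar_eq {O : Type} [DecidableEq O] (C : CurvedCocat K O) :
    cobar C = freeDG C.P (fun c => C.deg c + 1) (fun c => cobarDiff K C c) := by
  unfold cobar cobarDiff
  congr 1
  funext X Y c
  congr 1
  rw [Finsupp.linearCombination_apply]
  refine Finsupp.sum_congr fun s _ => ?_
  rw [smul_smul, mul_comm]

/-- The generators of the cobar-bar construction correspond to those of `I_n`. -/
def barEquivCGen (i j : Fin n) : (bar (kontsevich K n m)).P i j ≃ CGen n i j := strEquivCGen i j

theorem barEquivCGen_deg {i j : Fin n} (p : (bar (kontsevich K n m)).P i j) :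
    cDeg m (barEquivCGen K m i j p) = (bar (kontsevich K n m)).deg p + 1 := by
  change 1 - 2 * ((barStr K m p).wrap : ℤ) + m j - m i = (barStr K m p).sdeg (XGen.deg m) + 1
  rw [Str.sdeg_eq_wrap]
  ring

/-- The two minus signs of the generators in a product cancel, and `(-1)^|c''| = (-1)^(m_r + m_j)`
because the winding number enters the degree with an even coefficient. -/
theorem freeNegEquiv_linearCombination_Δ {i j : Fin n} (p : (bar (kontsevich K n m)).P i j) :
    freeNegEquiv (barEquivCGen K m) i j (Finsupp.linearCombination K
      (fun s : Σ Z : Fin n, (bar (kontsevich K n m)).P i Z × (bar (kontsevich K n m)).P Z j =>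
        (-1 : K) ^ (bar (kontsevich K n m)).deg s.2.2 •
          Finsupp.single (((Str.nil i).cons s.2.1).cons s.2.2) (1 : K))
        ((bar (kontsevich K n m)).Δ p)) =
      ((barStr K m p).splits.map fun s => (-1 : K) ^ (m s.1 + m j) •
        freeComp (cElt K s.2.2.wrap s.1 j) (cElt K s.2.1.wrap i s.1)).sum := by
  have h1 : ∀ f : (Σ Z : Fin n, (bar (kontsevich K n m)).P i Z × (bar (kontsevich K n m)).P Z j) →
      (Str (bar (kontsevich K n m)).P i j →₀ K),
      Finsupp.linearCombination K f ((bar (kontsevich K n m)).Δ p) =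
      ((barStr K m p).splits.map fun s => if h : s.2.1.len ≠ 0 ∧ s.2.2.len ≠ 0 then
        f ⟨s.1, ⟨s.2.1, h.1⟩, ⟨s.2.2, h.2⟩⟩ else 0).sum := by
    intro f
    have hΔ : (bar (kontsevich K n m)).Δ p = ((barStr K m p).splits.map fun s =>
        if h : s.2.1.len ≠ 0 ∧ s.2.2.len ≠ 0 then
          Finsupp.single (⟨s.1, ⟨s.2.1, h.1⟩, ⟨s.2.2, h.2⟩⟩ :
            Σ Z : Fin n, (bar (kontsevich K n m)).P i Z × (bar (kontsevich K n m)).P Z j) (1 : K)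
        else 0).sum := rfl
    rw [hΔ, map_list_sum, List.map_map]
    refine congrArg List.sum (List.map_congr_left fun s _ => ?_)
    simp only [Function.comp_apply]
    split_ifs with h
    · rw [Finsupp.linearCombination_single, one_smul]
    · exact map_zero _
  rw [h1, map_list_sum, List.map_map]
  refine congrArg List.sum (List.map_congr_left fun s _ => ?_)
  simp only [Function.comp_apply]
  split_ifs with h
  · rw [map_smul, freeNegEquiv_single,
      cElt_of_valid K (s.2.1.wrap_valid h.1), cElt_of_valid K (s.2.2.wrap_valid h.2),
      freeComp_single_single]
    have h2 : (bar (kontsevich K n m)).deg ⟨s.2.2, h.2⟩ = s.2.2.sdeg (XGen.deg m) := rfl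
    rw [h2, s.2.2.sdeg_eq_wrap,
      neg_one_zpow_congr (show _ % 2 = (m s.1 + m j) % 2 by omega)]
    simp only [Str.map, Str.len, Str.one, Str.append]
    norm_num
    rfl
  · rw [not_and_or, not_not, not_not] at h
    rw [map_zero]
    rcases h with h | h
    · rw [cElt_of_len_eq_zero K _ h, map_zero, smul_zero]
    · rw [cElt_of_len_eq_zero K _ h, map_zero, LinearMap.zero_apply, smul_zero]

/-- Curvature and coproduct enter the cobar differential with a minus sign, which survives because
neither a constant nor a product of two generators changes under the sign substitution. -/
theorem freeNegEquiv_cobarDiff {i j : Fin n} (p : (bar (kontsevich K n m)).P i j) :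
    freeNegEquiv (barEquivCGen K m) i j (cobarDiff K (bar (kontsevich K n m)) p) =
      - cDiff K m (barStr K m p).wrap i j := by
  rw [cobarDiff, bar_kontsevich_d, Finsupp.mapDomain_zero, sub_zero, map_sub, map_neg, map_smul,
    freeNegEquiv_freeDelta, bar_kontsevich_h_smul, freeNegEquiv_linearCombination_Δ,
    sum_splits_cElt, cDiff, neg_add, sub_eq_add_neg]

/-- The isomorphism of the cobar-bar construction of Kontsevich's category with the internal
DG-category. -/
theorem nonempty_cobarBarIso :
    Nonempty (DGIso (cobar (bar (kontsevich K n m))) (internalDG K n m)) := by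
  rw [cobar_eq, internalDG_eq]
  exact ⟨freeNegIso (barEquivCGen K m) (barEquivCGen_deg K m) (freeNegEquiv_cobarDiff K m)⟩

end CobarBar

/-! ### The A∞-relations with strict units -/

namespace Str

variable {O : Type} {Q : O → O → Type}

theorem sdeg_nil (d : ∀ {X Y : O}, Q X Y → ℤ) (X : O) : (nil X : Str Q X X).sdeg d = 0 := by
  simp [sdeg, deg, len]

theorem sdeg_cons (d : ∀ {X Y : O}, Q X Y → ℤ) {X Y Z : O} (p : Str Q X Y) (a : Q Y Z) :
    (p.cons a).sdeg d = p.sdeg d + d a - 1 := by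
  simp only [sdeg, deg, len]
  push_cast
  ring

variable {M : Type*} [AddCommMonoid M]

theorem sum_splits_of_snd {X Y : O} (p : Str Q X Y) (G : (Σ Z : O, Str Q X Z × Str Q Z Y) → M)
    (hG : ∀ s, s.2.2.len ≠ 0 → G s = 0) : (p.splits.map G).sum = G ⟨Y, p, nil Y⟩ := by
  cases p with
  | nil => simp [splits]
  | cons p a =>
    rw [splits, List.map_cons, List.sum_cons, List.map_map, List.sum_eq_zero, add_zero]
    intro x hx
    obtain ⟨s, -, rfl⟩ := List.mem_map.1 hx
    exact hG _ (by simp [len])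

theorem sum_splits_of_fst {X Y : O} (p : Str Q X Y) (G : (Σ Z : O, Str Q X Z × Str Q Z Y) → M)
    (hG : ∀ s, s.2.1.len ≠ 0 → G s = 0) : (p.splits.map G).sum = G ⟨X, nil X, p⟩ := by
  induction p with
  | nil => simp [splits]
  | cons p a ih =>
    rw [splits, List.map_cons, List.sum_cons, List.map_map, hG _ (by simp [len]), zero_add]
    exact ih (fun s => G ⟨s.1, s.2.1, cons s.2.2 a⟩) fun s hs => hG _ hs

theorem sum_splits_of_fst_one {X Y Z : O} (b : Q X Y) (r : Str Q Y Z)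
    (G : (Σ W : O, Str Q X W × Str Q W Z) → M)
    (hG : ∀ s, s.2.1.len ≠ 1 → G s = 0) :
    ((((one b).append r).splits).map G).sum = G ⟨Y, one b, r⟩ := by
  induction r with
  | nil =>
    have h := hG ⟨X, nil X, one b⟩ (by simp [len])
    simp only [one] at h
    simp [one, splits, h]
  | cons p a ih =>
    rw [append_cons, splits, List.map_cons, List.sum_cons, List.map_map,
      hG _ (by simp [len, len_append, one]), zero_add]
    exact ih (fun s => G ⟨s.1, s.2.1, cons s.2.2 a⟩) fun s hs => hG _ hs

theorem eq_nil_or_one_append {X Y : O} (p : Str Q X Y) :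
    p.len = 0 ∨ ∃ (Z : O) (b : Q X Z) (r : Str Q Z Y), p = (one b).append r := by
  induction p with
  | nil => exact Or.inl rfl
  | cons p a ih =>
    right
    cases p with
    | nil => exact ⟨_, a, nil _, rfl⟩
    | cons p c =>
      obtain ⟨Z, b, r, h⟩ := ih.resolve_left (by simp [len])
      exact ⟨Z, b, r.cons a, by rw [h, append_cons]⟩

theorem toGen?_map_gen {X Y : O} (q : Str Q X Y) :
    (q.map fun _ _ => UBasis.gen).toGen? = some q := by
  induction q with
  | nil => rfl
  | cons q a ih => simp [map, toGen?, ih, UBasis.snoc?]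

theorem eq_map_gen_of_toGen? {X Y : O} {p : Str (UBasis Q) X Y} {q : Str Q X Y}
    (h : p.toGen? = some q) : p = q.map fun _ _ => UBasis.gen := by
  induction p with
  | nil => simp only [toGen?, Option.some.injEq] at h; subst h; rfl
  | cons p b ih =>
    cases b with
    | e => simp [toGen?, UBasis.snoc?] at h
    | gen a =>
      simp only [toGen?, Option.bind_eq_some_iff] at h
      obtain ⟨q', hq', h⟩ := h
      simp only [UBasis.snoc?, Option.some.injEq] at h
      subst h
      rw [map, ← ih hq']

theorem toGen?_cons_e {X Y : O} (p : Str (UBasis Q) X Y) : (p.cons (.e Y)).toGen? = none := by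
  simp [toGen?, UBasis.snoc?]

theorem toGen?_append_left {X Y Z : O} {u : Str (UBasis Q) X Y} (hu : u.toGen? = none)
    (t : Str (UBasis Q) Y Z) : (u.append t).toGen? = none := by
  induction t with
  | nil => exact hu
  | cons t a ih => simp [append_cons, toGen?, ih]

theorem toGen?_append_right {X Y Z : O} (u : Str (UBasis Q) X Y) {t : Str (UBasis Q) Y Z}
    (ht : t.toGen? = none) : (u.append t).toGen? = none := by
  induction t with
  | nil => simp [toGen?] at ht
  | cons t a ih =>
    cases a with
    | e => exact toGen?_cons_e _
    | gen a =>
      have : t.toGen? = none := by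
        cases h : t.toGen? with
        | none => rfl
        | some q => simp [toGen?, h, UBasis.snoc?] at ht
      simp [append_cons, toGen?, ih this]

theorem toGen?_insert_e {X Y Z : O} (u : Str (UBasis Q) X Y) (t : Str (UBasis Q) Y Z) :
    (u.insert (.e Y) t).toGen? = none :=
  toGen?_append_left (toGen?_cons_e u) t

/-- The value of `F` at the string without its first arrow, if that is a unit, and `0` otherwise. -/
def leadVal {X Y : O} : Str (UBasis Q) X Y → (Str (UBasis Q) X Y → M) → M
  | nil _, _ => 0
  | cons (nil _) (.e _), F => F (nil _)
  | cons p a, F => leadVal p fun w => F (w.cons a)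

theorem leadVal_cons_cons {X Y Z W : O} (p : Str (UBasis Q) X Y) (b : UBasis Q Y Z)
    (a : UBasis Q Z W) (F : Str (UBasis Q) X W → M) :
    ((p.cons b).cons a).leadVal F = (p.cons b).leadVal fun w => F (w.cons a) := rfl

theorem leadVal_zero {X Y : O} (p : Str (UBasis Q) X Y) :
    (p.leadVal fun _ => (0 : M)) = 0 := by
  induction p with
  | nil => rfl
  | cons p a ih =>
    cases p with
    | nil => cases a <;> rfl
    | cons p b => exact ih

theorem leadVal_one_e_append {X Y : O} (r : Str (UBasis Q) X Y) (F : Str (UBasis Q) X Y → M) :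
    ((one (.e X)).append r).leadVal F = F r := by
  induction r with
  | nil => rfl
  | cons r a ih =>
    have := ih fun w => F (w.cons a)
    cases r <;> exact this

theorem leadVal_one_gen_append {X Y Z : O} (y : Q X Y) (r : Str (UBasis Q) Y Z)
    (F : Str (UBasis Q) X Z → M) : ((one (.gen y)).append r).leadVal F = 0 := by
  induction r with
  | nil => rfl
  | cons r a ih =>
    have := ih fun w => F (w.cons a)
    cases r <;> exact this

end Str

/-! ### Products with units and the remaining operations -/

namespace AInfCat

open Str

variable {K : Type u} [Field K] {O : Type} (A : AInfCat K O)

/-- The part of the operations that is determined by strict unitality. -/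
def opU {X Y : O} : Str A.B X Y → A.Hom X Y
  | .cons (.cons (.nil _) (.e _)) a => Finsupp.single a 1
  | .cons (.cons (.nil _) (.gen a)) (.e _) => (-1 : K) ^ A.deg a • Finsupp.single (.gen a) 1
  | _ => 0

/-- The part of the operations that vanishes if a unit occurs among the inputs. -/
def opC {X Y : O} (p : Str A.B X Y) : A.Hom X Y :=
  match p.toGen? with
  | some q => A.m q
  | none => 0

variable {A}

theorem opC_of_none {X Y : O} {p : Str A.B X Y} (h : p.toGen? = none) : A.opC p = 0 := by
  simp [opC, h]

theorem opC_of_some {X Y : O} {p : Str A.B X Y} {q : Str A.Q X Y} (h : p.toGen? = some q) :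
    A.opC p = A.m q := by
  simp [opC, h]

theorem opU_of_len_ne_two {X Y : O} (p : Str A.B X Y) (h : p.len ≠ 2) : A.opU p = 0 := by
  match p with
  | .nil _ => rfl
  | .cons (.nil _) _ => rfl
  | .cons (.cons (.nil _) _) _ => simp [len] at h
  | .cons (.cons (.cons _ _) _) _ => rfl

/-- The two parts never overlap: a string on which `opU` is non-zero contains a unit and is killed
by `opC`. -/
theorem op_eq {X Y : O} (p : Str A.B X Y) : A.op p = A.opU p + A.opC p := by
  match p with
  | .nil _ => exact (zero_add _).symm
  | .cons (.nil _) _ => exact (zero_add _).symm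
  | .cons (.cons (.nil _) (.e _)) (.e _) =>
    simp [opU, op, opC, toGen?, UBasis.snoc?]
  | .cons (.cons (.nil _) (.e _)) (.gen _) => simp [opU, op, opC, toGen?, UBasis.snoc?]
  | .cons (.cons (.nil _) (.gen _)) (.e _) => simp [opU, op, opC, toGen?, UBasis.snoc?]
  | .cons (.cons (.nil _) (.gen _)) (.gen _) => exact (zero_add _).symm
  | .cons (.cons (.cons _ _) _) _ => exact (zero_add _).symm

/-! ### Sums over insertions of an operation -/

variable {M : Type*} [AddCommGroup M] [Module K M]

/-- The sum of the values of `F` at the strings obtained by applying the operation `o` to a part of a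
given string. -/
def insertSum (o : ∀ {X Y : O}, Str A.B X Y → A.Hom X Y) {X Y : O} (F : Str A.B X Y → M)
    (p : Str A.B X Y) : M :=
  p.sum₃ fun u v t => (-1 : K) ^ u.sdeg A.bdeg •
    Finsupp.linearCombination K (fun b => F (u.insert b t)) (o v)

variable {o : ∀ {X Y : O}, Str A.B X Y → A.Hom X Y}

theorem insertSum_nil {X : O} (F : Str A.B X X → M) : insertSum o F (nil X) = 0 := by
  simp [insertSum, sum₃, splits, len]

/-- The recursion separates the insertions whose operation consumes the last arrow from those that
leave it in place. -/
theorem insertSum_cons {X Y Z : O} (F : Str A.B X Z → M) (p : Str A.B X Y) (a : A.B Y Z) :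
    insertSum o F (p.cons a) =
      (p.splits.map fun s => (-1 : K) ^ s.2.1.sdeg A.bdeg •
        Finsupp.linearCombination K (fun b => F (s.2.1.cons b)) (o (s.2.2.cons a))).sum +
      insertSum o (fun w => F (w.cons a)) p := by
  simp only [insertSum, sum₃]
  rw [splits, List.map_cons, List.sum_cons, List.map_map, ← List.sum_map_add]
  simp only [splits, List.map_cons, List.map_nil, List.sum_cons, List.sum_nil, len, if_true,
    add_zero, zero_add]
  refine congrArg List.sum (List.map_congr_left fun s _ => ?_)
  simp only [Function.comp_apply, splits, List.map_cons, List.sum_cons, List.map_map]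
  rw [if_neg (by simp [len])]
  rfl

theorem insertSum_eq_zero {X Y : O} (F : Str A.B X Y → M)
    (hF : ∀ {Z W : O} (u : Str A.B X Z) (v : Str A.B Z W) (t : Str A.B W Y),
      Finsupp.linearCombination K (fun b => F (u.insert b t)) (o v) = 0) (p : Str A.B X Y) :
    insertSum o F p = 0 := by
  simp only [insertSum, sum₃]
  refine List.sum_eq_zero ?_
  intro x hx
  obtain ⟨s, -, rfl⟩ := List.mem_map.1 hx
  refine List.sum_eq_zero ?_
  intro y hy
  obtain ⟨r, -, rfl⟩ := List.mem_map.1 hy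
  rw [hF, smul_zero, ite_self]

theorem insertSum_op {X Y : O} (F : Str A.B X Y → M) (p : Str A.B X Y) :
    insertSum A.op F p = insertSum A.opU F p + insertSum A.opC F p := by
  induction p with
  | nil => simp only [insertSum_nil, add_zero]
  | cons p a ih =>
    simp only [insertSum_cons, ih, op_eq, map_add, smul_add, List.sum_map_add]
    abel

theorem insertSum_add {X Y : O} (F G : Str A.B X Y → M) (p : Str A.B X Y) :
    insertSum o (fun w => F w + G w) p = insertSum o F p + insertSum o G p := by
  have h : ∀ {Z W : O} (F G : A.B Z W → M) (x : A.Hom Z W),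
      Finsupp.linearCombination K (fun b => F b + G b) x =
        Finsupp.linearCombination K F x + Finsupp.linearCombination K G x := by
    intro Z W F G x
    simp only [Finsupp.linearCombination_apply, smul_add, Finsupp.sum_add]
  induction p with
  | nil => simp only [insertSum_nil, add_zero]
  | cons p a ih =>
    simp only [insertSum_cons, ih, h, smul_add, List.sum_map_add]
    abel

theorem linearCombination_zero_fun {α : Type*} (F : α → M) (hF : ∀ b, F b = 0) (x : α →₀ K) :
    Finsupp.linearCombination K F x = 0 := by
  rw [Finsupp.linearCombination_apply]
  exact Finset.sum_eq_zero fun b _ => by simp only [hF, smul_zero]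

theorem insertSum_zero {X Y : O} (p : Str A.B X Y) : insertSum o (fun _ => (0 : M)) p = 0 :=
  insertSum_eq_zero (o := o) (fun _ => (0 : M))
    (fun _ v _ => linearCombination_zero_fun (fun _ => (0 : M)) (fun _ => rfl) (o v)) p

theorem insertSum_of_len_ne_one {X Y : O} (F : Str A.B X Y → M) (hF : ∀ w, w.len ≠ 1 → F w = 0)
    (p : Str A.B X Y) (hp : p.len ≠ 0) :
    insertSum o F p = Finsupp.linearCombination K (fun b => F (one b)) (o p) := by
  cases p with
  | nil => simp [len] at hp
  | cons p a =>
    rw [insertSum_cons, sum_splits_of_fst, insertSum_eq_zero, add_zero, sdeg_nil, zpow_zero,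
      one_smul]
    · rfl
    · intro Z W u v t
      refine linearCombination_zero_fun _ (fun b => hF _ ?_) _
      have := insert_len_ne_zero u b t
      simp only [len]
      omega
    · intro s hs
      refine smul_eq_zero_of_right _ (linearCombination_zero_fun _ (fun b => hF _ ?_) _)
      simp only [len]
      omega

variable (A) in
/-- Minus the signed value of `F` at the string without its last arrow, if that is a unit, and `0`
otherwise. -/
def trailVal {X Y : O} : Str A.B X Y → (Str A.B X Y → M) → M
  | cons p (.e _), F => -((-1 : K) ^ p.sdeg A.bdeg • F p)
  | _, _ => 0

theorem insertSum_opU_cons_cons {X Y Z W : O} (F : Str A.B X W → M) (p : Str A.B X Y)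
    (b : A.B Y Z) (a : A.B Z W) :
    insertSum A.opU F ((p.cons b).cons a) =
      (-1 : K) ^ p.sdeg A.bdeg •
        Finsupp.linearCombination K (fun c => F (p.cons c)) (A.opU ((one b).cons a)) +
      insertSum A.opU (fun w => F (w.cons a)) (p.cons b) := by
  rw [insertSum_cons]
  congr 1
  rw [splits, List.map_cons, List.sum_cons, opU_of_len_ne_two _ (by simp [len]), map_zero,
    smul_zero, zero_add, List.map_map, sum_splits_of_snd]
  · rfl
  · intro s hs
    simp only [Function.comp_apply]
    rw [opU_of_len_ne_two, map_zero, smul_zero]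
    simp only [len]
    omega

/-- If `F` vanishes on strings in which a unit occurs, then inserting products with units in a string
gives terms that cancel, except for those coming from units at the ends. -/
theorem insertSum_opU_eq {X Y : O} (F : Str A.B X Y → M)
    (hF : ∀ w, w.toGen? = none → F w = 0) (p : Str A.B X Y) :
    insertSum A.opU F p = p.leadVal F + A.trailVal p F := by
  induction p with
  | nil => simp [insertSum_nil, leadVal, trailVal]
  | cons p a ih =>
    cases p with
    | nil =>
      have h : insertSum A.opU F ((nil X).cons a) = 0 := by
        rw [insertSum_cons, insertSum_nil, add_zero]
        simp only [splits, List.map_cons, List.map_nil, List.sum_cons, List.sum_nil, add_zero]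
        rw [opU_of_len_ne_two _ (by simp [len]), map_zero, smul_zero]
      rw [h]
      cases a with
      | e => simp [leadVal, trailVal, sdeg_nil]
      | gen a => simp [leadVal, trailVal]
    | cons p b =>
      rw [insertSum_opU_cons_cons, leadVal_cons_cons]
      cases a with
      | e =>
        -- If the last arrow is a unit, any insertion that keeps it is killed by `F`; only the
        -- product of the last two arrows remains, and it gives the trailing term.
        have h0 : (fun w : Str A.B X _ => F (w.cons (UBasis.e _))) = fun _ => 0 :=
          funext fun w => hF _ (toGen?_cons_e w)
        have h2 := insertSum_zero (o := A.opU) (M := M) (p.cons b)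
        rw [h0, leadVal_zero, h2, add_zero, zero_add]
        cases b with
        | e =>
          simp [opU, one, trailVal, hF _ (toGen?_cons_e p)]
        | gen b =>
          have h3 : A.bdeg (UBasis.gen b : A.B _ _) = A.deg b := rfl
          simp only [opU, one, trailVal, map_smul, Finsupp.linearCombination_single, one_smul,
            smul_smul, neg_one_zpow_mul, sdeg_cons, h3]
          rw [neg_one_zpow_neg (a := p.sdeg A.bdeg + A.deg b)
            (b := p.sdeg A.bdeg + A.deg b - 1) (by omega), neg_smul]
      | gen a =>
        have h1 := ih (fun w => F (w.cons (.gen a))) fun w hw => hF _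
          (toGen?_append_left hw (one (.gen a)))
        rw [h1]
        cases b with
        | e =>
          -- The unit `b` may be absorbed by `a` or by what precedes it. The first product cancels
          -- the trailing term of the shorter string.
          simp only [opU, one, trailVal, Finsupp.linearCombination_single, one_smul]
          abel
        | gen b => simp [opU, one, trailVal]

theorem linearCombination_opC {X Y : O}
    (hm : ∀ {X Y : O} (q : Str A.Q X Y) (a : A.Q X Y), A.m q (.gen a) = 0) (F : A.B X Y → M)
    (hF : ∀ b, (∀ a, b ≠ .gen a) → F b = 0) (p : Str A.B X Y) :
    Finsupp.linearCombination K F (A.opC p) = 0 := by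
  cases h : p.toGen? with
  | none => rw [opC_of_none h, map_zero]
  | some q =>
    rw [opC_of_some h, Finsupp.linearCombination_apply]
    refine Finset.sum_eq_zero fun b _ => ?_
    by_cases hb : ∃ a, b = .gen a
    · obtain ⟨a, rfl⟩ := hb
      simp only [hm, zero_smul]
    · simp only [hF b (fun a ha => hb ⟨a, ha⟩), smul_zero]

/-- By `hm` inserting a value of `opC` puts units into the string, where `F` vanishes; only the
products with units contribute. -/
theorem insertSum_op_eq (hm : ∀ {X Y : O} (q : Str A.Q X Y) (a : A.Q X Y), A.m q (.gen a) = 0)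
    {X Y : O} (F : Str A.B X Y → M) (hF : ∀ w, w.toGen? = none → F w = 0) (p : Str A.B X Y) :
    insertSum A.op F p = p.leadVal F + A.trailVal p F := by
  rw [insertSum_op, insertSum_opU_eq F hF, insertSum_eq_zero, add_zero]
  intro Z W u v t
  refine linearCombination_opC hm _ (fun b hb => hF _ ?_) v
  cases b with
  | e => exact toGen?_insert_e u t
  | gen a => exact absurd rfl (hb a)

/-- There is no sign because the values of `opC` lie in the span of the units, which have degree
zero. -/
theorem opC_e (hm : ∀ {X Y : O} (q : Str A.Q X Y) (a : A.Q X Y), A.m q (.gen a) = 0)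
    {X Y : O} (p : Str A.B X Y) :
    Finsupp.linearCombination K (fun c => A.opU ((one c).cons (.e Y))) (A.opC p) = A.opC p := by
  cases h : p.toGen? with
  | none => rw [opC_of_none h, map_zero]
  | some q =>
    rw [opC_of_some h, Finsupp.linearCombination_apply]
    conv_rhs => rw [← Finsupp.sum_single (A.m q)]
    refine Finsupp.sum_congr fun b _ => ?_
    cases b with
    | e => simp [opU, one]
    | gen a => simp [hm]

theorem opU_e_left {X Y : O} (p : A.Hom X Y) :
    Finsupp.linearCombination K (fun c => A.opU ((one (.e X)).cons c)) p = p := by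
  rw [Finsupp.linearCombination_apply]
  conv_rhs => rw [← Finsupp.sum_single p]
  refine Finsupp.sum_congr fun b _ => ?_
  simp [opU, one]

/-- Associativity of products in which at most one factor is not a unit. -/
theorem opU_opU {X Y Z W : O} (b : A.B X Y) (r : Str A.B Y Z) (a : A.B Z W) :
    (-1 : K) ^ (A.bdeg b - 1) •
        Finsupp.linearCombination K (fun c => A.opU ((one b).cons c)) (A.opU (r.cons a)) +
      Finsupp.linearCombination K (fun c => A.opU ((one c).cons a))
        (A.opU ((one b).append r)) = 0 := by
  cases r with
  | nil =>
    rw [opU_of_len_ne_two _ (by simp [len]), opU_of_len_ne_two _ (by simp [len, one])]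
    simp
  | cons r b' =>
    cases r with
    | cons r b'' =>
      rw [opU_of_len_ne_two _ (by simp [len]),
        opU_of_len_ne_two _ (by simp [len, len_append, one])]
      simp
    | nil =>
      have h0 : ∀ {X Y : O} (a : A.Q X Y), A.bdeg (UBasis.gen a : A.B X Y) = A.deg a := fun a => rfl
      have h1 : ∀ X : O, A.bdeg (UBasis.e X : A.B X X) = 0 := fun a => rfl
      have hs : ∀ z : ℤ, (-1 : K) ^ (z - 1) = -(-1) ^ z := fun z => neg_one_zpow_neg (by omega)
      cases b <;> cases b' <;> cases a <;>
        simp [opU, one, h0, h1, hs, Finsupp.linearCombination_single]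

end AInfCat

/-! ### Kontsevich's category satisfies the A∞-axioms -/

section KontsevichAInf

open AInfCat Str

variable {K : Type u} [Field K]

theorem Str.sdeg_one {O : Type} {Q : O → O → Type} (d : ∀ {X Y : O}, Q X Y → ℤ) {X Y : O}
    (a : Q X Y) : (one a).sdeg d = d a - 1 := by
  rw [one, sdeg_cons, sdeg_nil, zero_add]

/-- Since `opU` needs exactly two inputs, the inner operation must take everything except the first
or except the last arrow. -/
theorem AInfCat.insertSum_op_opU {O : Type} {A : AInfCat K O} {X Y Z W : O} (b : A.B X Y)
    (r : Str A.B Y Z) (a : A.B Z W) :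
    insertSum A.op A.opU (((one b).append r).cons a) =
      (-1 : K) ^ (A.bdeg b - 1) •
        Finsupp.linearCombination K (fun c => A.opU ((one b).cons c)) (A.op (r.cons a)) +
      Finsupp.linearCombination K (fun c => A.opU ((one c).cons a))
        (A.op ((one b).append r)) := by
  rw [insertSum_cons, sum_splits_of_fst_one, insertSum_of_len_ne_one, sdeg_one]
  · intro w hw
    refine opU_of_len_ne_two _ ?_
    simp only [len]
    omega
  · simp only [len_append, one, len]
    omega
  · intro s hs
    refine smul_eq_zero_of_right _ (linearCombination_zero_fun _ (fun c => ?_) _)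
    refine opU_of_len_ne_two _ ?_
    simp only [len]
    omega

theorem AInfCat.opU_deg {O : Type} {A : AInfCat K O} {X Y : O} (p : Str A.B X Y) :
    ∀ b ∈ (A.opU p).support, A.bdeg b = p.deg A.bdeg + 2 - p.len := by
  match p with
  | .nil _ => simp [opU]
  | .cons (.nil _) _ => simp [opU]
  | .cons (.cons (.nil _) (.e _)) a =>
    intro b hb
    simp only [opU] at hb
    have := Finsupp.support_single_subset hb
    rw [Finset.mem_singleton] at this
    subst this
    simp [Str.deg, len, bdeg, UBasis.deg]
  | .cons (.cons (.nil _) (.gen a)) (.e _) =>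
    intro b hb
    simp only [opU] at hb
    have := Finsupp.support_single_subset (Finsupp.support_smul hb)
    rw [Finset.mem_singleton] at this
    subst this
    simp [Str.deg, len, bdeg, UBasis.deg]
  | .cons (.cons (.nil _) (.gen _)) (.gen _) => simp [opU]
  | .cons (.cons (.cons _ _) _) _ => simp [opU]

theorem Str.sdeg_map_gen {O : Type} (A : AInfCat K O) {X Y : O} (q : Str A.Q X Y) :
    (q.map fun _ _ => UBasis.gen : Str A.B X Y).sdeg A.bdeg = q.sdeg A.deg := by
  rw [sdeg, sdeg, len_map, deg_map (deg := A.deg) (deg' := A.bdeg)]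
  intro X Y a
  rfl

variable (K) {n : ℕ} [NeZero n] (m : Fin n → ℤ)

theorem kontsevich_m_gen {i j : Fin n} (q : Str (kontsevich K n m).Q i j)
    (a : (kontsevich K n m).Q i j) : (kontsevich K n m).m q (.gen a) = 0 :=
  DFunLike.congr_fun (genPart_kontsevich_m K m q) a

/-- For `𝔪_n` the degree condition says that a closed path of winding number one has shifted degree
`-2`. -/
theorem kontsevich_op_deg {i j : Fin n} (p : Str (kontsevich K n m).B i j)
    (b : (kontsevich K n m).B i j) (hb : b ∈ ((kontsevich K n m).op p).support) :
    (kontsevich K n m).bdeg b = p.deg (kontsevich K n m).bdeg + 2 - p.len := by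
  classical
  rw [op_eq] at hb
  rcases Finset.mem_union.1 (Finsupp.support_add hb) with hb | hb
  · exact opU_deg p b hb
  · cases h : p.toGen? with
    | none => rw [opC_of_none h] at hb; simp at hb
    | some q =>
      rw [opC_of_some h] at hb
      have h1 : p.deg (kontsevich K n m).bdeg - p.len = q.sdeg (XGen.deg m) := by
        rw [eq_map_gen_of_toGen? h]
        exact sdeg_map_gen (kontsevich K n m) q
      by_cases hq : q.len = n
      · obtain ⟨hw, hij⟩ := (len_eq_card_iff q).1 hq
        rw [kontsevich_m_of_eq K m q hq hij] at hb
        subst hij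
        rw [q.sdeg_eq_wrap, hw] at h1
        have := Finsupp.support_single_subset hb
        rw [Finset.mem_singleton] at this
        subst this
        simp only [UBasis.ofEq, bdeg, UBasis.deg] at h1 ⊢
        push_cast at h1
        linarith
      · rw [kontsevich_m_of_ne K m q hq] at hb
        simp at hb

theorem kontsevich_opC_nil {i j : Fin n} (p : Str (kontsevich K n m).B i j) (hp : p.len = 0) :
    (kontsevich K n m).opC p = 0 := by
  cases p with
  | cons p a => simp [len] at hp
  | nil =>
    rw [opC_of_some (q := nil i) rfl]
    exact kontsevich_m_of_ne K m (nil i) (by simpa [len] using (NeZero.ne n).symm)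

/-- The relation for a string `(x_i, …, x_i)` that is one arrow longer than the circle. -/
theorem kontsevich_rel_gen {i j k l : Fin n} (y : (kontsevich K n m).Q i j)
    (r : Str (kontsevich K n m).B j k) (a : (kontsevich K n m).Q k l) :
    (-1 : K) ^ ((kontsevich K n m).deg y - 1) •
        Finsupp.linearCombination K
          (fun c => (kontsevich K n m).opU ((one (.gen y)).cons c))
          ((kontsevich K n m).opC (r.cons (.gen a))) +
      Finsupp.linearCombination K (fun c => (kontsevich K n m).opU ((one c).cons (.gen a)))
        ((kontsevich K n m).opC ((one (.gen y)).append r)) = 0 := by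
  cases h : r.toGen? with
  | none =>
    rw [opC_of_none (toGen?_append_right _ h),
      opC_of_none (show (r.cons (.gen a)).toGen? = none by simp [toGen?, h])]
    simp
  | some q =>
    obtain rfl := eq_map_gen_of_toGen? h
    have h1 : (kontsevich K n m).opC ((one (.gen y)).append (q.map fun _ _ => UBasis.gen)) =
        (kontsevich K n m).m ((one y).append q) :=
      opC_of_some (by
        have := toGen?_map_gen ((one y).append q)
        rwa [map_append] at this)
    have h2 : (kontsevich K n m).opC ((q.map fun _ _ => UBasis.gen).cons (.gen a)) =
        (kontsevich K n m).m (q.cons a) := opC_of_some (toGen?_map_gen (q.cons a))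
    rw [h1, h2]
    have hl1 : ((one y).append q).len = q.len + 1 := by
      simp only [len_append, one, len]; omega
    have hl2 : (q.cons a).len = q.len + 1 := rfl
    by_cases hn : q.len + 1 = n
    -- Both strings of `n` arrows are closed, so the first and last arrows of the long string are
    -- parallel and hence equal. The two products with the resulting units cancel because the sign
    -- of `𝔪_2(e, a)` meets `(-1)^(|a| - 1)`.
    · obtain rfl := eq_of_len_eq_card _ (hl1.trans hn)
      obtain rfl := eq_of_len_eq_card _ (hl2.trans hn)
      obtain rfl : a = y := (XGen.subsingleton _ _).elim a y
      have e1 := kontsevich_m_of_eq K m _ (hl1.trans hn) rfl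
      have e2 := kontsevich_m_of_eq K m _ (hl2.trans hn) rfl
      have hs : (-1 : K) ^ ((kontsevich K n m).deg a - 1) * (-1) ^ (kontsevich K n m).deg a = -1 := by
        rw [neg_one_zpow_mul, neg_one_zpow_eq_neg_one (by omega)]
      rw [e1, e2]
      simp only [Finsupp.linearCombination_single, one_smul, UBasis.ofEq, one, opU]
      rw [smul_smul, hs]
      simp
    · have e1 := kontsevich_m_of_ne K m _ (fun h => hn (hl1.symm.trans h))
      have e2 := kontsevich_m_of_ne K m _ (fun h => hn (hl2.symm.trans h))
      rw [e1, e2]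
      simp

theorem kontsevich_sdeg_of_opC_ne_zero {i j : Fin n} (p : Str (kontsevich K n m).B i j)
    (hp : (kontsevich K n m).opC p ≠ 0) : p.sdeg (kontsevich K n m).bdeg = -2 := by
  cases h : p.toGen? with
  | none => exact absurd (opC_of_none h) hp
  | some q =>
    rw [opC_of_some h] at hp
    have hq : q.len = n := by
      by_contra hq
      exact hp (kontsevich_m_of_ne K m q hq)
    obtain ⟨hw, hij⟩ := (len_eq_card_iff q).1 hq
    subst hij
    rw [eq_map_gen_of_toGen? h, sdeg_map_gen]
    refine (q.sdeg_eq_wrap m).trans ?_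
    rw [hw]
    push_cast
    ring

/-- The outer operation is split. The outer `opC` leaves only end terms. The outer `opU` gives
associativity with units when the inner operation is `opU`; when it is `opC`, the result cancels the
end terms, or cancels itself if both ends are non-units. -/
theorem kontsevich_rel {i j : Fin n} (p : Str (kontsevich K n m).B i j) :
    insertSum (kontsevich K n m).op (fun w => (kontsevich K n m).op w) p = 0 := by
  have hop : (fun w : Str (kontsevich K n m).B i j => (kontsevich K n m).op w) =
      fun w => (kontsevich K n m).opU w + (kontsevich K n m).opC w := funext op_eq
  rw [hop, insertSum_add, insertSum_op_eq (kontsevich_m_gen K m) _ (fun w => opC_of_none)]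
  cases p with
  | nil => simp [insertSum_nil, leadVal, trailVal]
  | cons p a =>
    rcases eq_nil_or_one_append p with hp | ⟨_, b, r, rfl⟩
    · cases p with
      | cons p c => simp [len] at hp
      | nil =>
        have h0 := kontsevich_opC_nil K m (nil i) rfl
        have h1 : insertSum (kontsevich K n m).op (kontsevich K n m).opU ((nil i).cons a) = 0 := by
          rw [insertSum_cons, insertSum_nil, add_zero]
          refine List.sum_eq_zero fun x hx => ?_
          simp only [splits, List.map_cons, List.map_nil, List.mem_singleton] at hx
          rw [hx]
          exact smul_eq_zero_of_right _
            (linearCombination_zero_fun _ (fun c => opU_of_len_ne_two _ (by simp [len])) _)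
        rw [h1, zero_add]
        cases a with
        | e => simp [leadVal, trailVal, h0]
        | gen a => simp [leadVal, trailVal]
    · rw [insertSum_op_opU, op_eq, op_eq, map_add, map_add, smul_add]
      have hU := opU_opU b r a
      have hC : (-1 : K) ^ ((kontsevich K n m).bdeg b - 1) •
            Finsupp.linearCombination K (fun c => (kontsevich K n m).opU ((one b).cons c))
              ((kontsevich K n m).opC (r.cons a)) +
          Finsupp.linearCombination K (fun c => (kontsevich K n m).opU ((one c).cons a))
            ((kontsevich K n m).opC ((one b).append r)) +
          ((((one b).append r).cons a).leadVal (kontsevich K n m).opC +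
            (kontsevich K n m).trailVal (((one b).append r).cons a) (kontsevich K n m).opC) = 0 := by
        cases a with
        | e =>
          have h1 : (((one b).append r).cons (.e _)).leadVal (kontsevich K n m).opC = 0 := by
            rw [← append_cons]
            cases b with
            | e => rw [leadVal_one_e_append]; exact opC_of_none (toGen?_cons_e r)
            | gen y => exact leadVal_one_gen_append _ _ _
          rw [h1, opC_of_none (toGen?_cons_e r), opC_e (kontsevich_m_gen K m), map_zero, smul_zero,
            zero_add, zero_add, trailVal]
          by_cases h : (kontsevich K n m).opC ((one b).append r) = 0
          · rw [h]; simp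
          -- The trailing term carries the sign `-(-1)^(-2) = -1`, opposite to the product with the
          -- final unit.
          · rw [kontsevich_sdeg_of_opC_ne_zero K m _ h]
            simp
        | gen a =>
          have h2 : (kontsevich K n m).trailVal (((one b).append r).cons (.gen a))
              (kontsevich K n m).opC = 0 := rfl
          rw [h2, add_zero, ← append_cons]
          cases b with
          | e =>
            rw [leadVal_one_e_append, opU_e_left, opC_of_none (p := (one (.e _)).append r)
              (toGen?_append_left rfl r), map_zero, add_zero]
            have h3 : (kontsevich K n m).bdeg (.e i) = 0 := rfl
            rw [h3, neg_one_zpow_eq_neg_one (by norm_num), neg_one_smul, neg_add_cancel]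
          | gen y =>
            rw [leadVal_one_gen_append, add_zero]
            exact kontsevich_rel_gen K m y r a
      have := congrArg₂ (· + ·) hU hC
      simp only [add_zero] at this
      rw [← this]
      abel

theorem kontsevich_isAInf : (kontsevich K n m).IsAInf where
  no_curv X := kontsevich_m_of_ne K m (nil X) (by simpa [len] using (NeZero.ne n).symm)
  op_deg := kontsevich_op_deg K m
  rel := kontsevich_rel K m

end KontsevichAInf

/-! ### The A∞-functor to the internal DG-category -/

section Functor

open AInfCat Str

namespace Str

variable {O : Type} {Q : O → O → Type}

theorem splits_map {P : O → O → Type} (e : ∀ X Y, Q X Y → P X Y) {X Y : O} (p : Str Q X Y) :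
    (p.map e).splits = p.splits.map fun s => ⟨s.1, s.2.1.map e, s.2.2.map e⟩ := by
  induction p with
  | nil => rfl
  | cons p a ih =>
    simp only [map, splits, ih, List.map_cons, List.map_map]
    rfl

end Str

variable (K : Type u) [Field K] {n : ℕ}

/-- The value of the functor on the string that consists of one unit. -/
def unitVal {O : Type} {Q P : O → O → Type} {X Y : O} : Str (UBasis Q) X Y → (Str P X Y →₀ K)
  | .cons (.nil _) (.e _) => Finsupp.single (.nil _) 1
  | _ => 0

variable {K} in
theorem unitVal_of_len_ne_one {O : Type} {Q P : O → O → Type} {X Y : O} (w : Str (UBasis Q) X Y)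
    (h : w.len ≠ 1) : (unitVal K w : Str P X Y →₀ K) = 0 := by
  match w with
  | .nil _ => rfl
  | .cons (.nil _) _ => simp [len] at h
  | .cons (.cons _ _) _ => rfl

variable [NeZero n] (m : Fin n → ℤ)

/-- The values of the functor on strings without units. -/
def genVal {i j : Fin n} (w : Str (kontsevich K n m).B i j) : Str (CGen n) i j →₀ K :=
  match w.toGen? with
  | some q => - cElt K (wrap q) i j
  | none => 0

variable {K m}

theorem genVal_of_none {i j : Fin n} {w : Str (kontsevich K n m).B i j} (h : w.toGen? = none) :
    genVal K m w = 0 := by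
  simp [genVal, h]

theorem genVal_of_some {i j : Fin n} {w : Str (kontsevich K n m).B i j}
    {q : Str (XGen n) i j} (h : w.toGen? = some q) :
    genVal K m w = - cElt K q.wrap i j := by
  unfold genVal
  rw [h]

variable (K m) in
/-- A string of the arrows `x_i` as a string of basis morphisms. -/
def genStr {i j : Fin n} (q : Str (XGen n) i j) : Str (kontsevich K n m).B i j :=
  q.map fun _ _ => UBasis.gen

theorem toGen?_genStr {i j : Fin n} (q : Str (XGen n) i j) : (genStr K m q).toGen? = some q :=
  toGen?_map_gen q

theorem eq_genStr {i j : Fin n} {p : Str (kontsevich K n m).B i j} {q : Str (XGen n) i j}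
    (h : p.toGen? = some q) : p = genStr K m q := eq_map_gen_of_toGen? h

theorem sdeg_genStr {i j : Fin n} (q : Str (XGen n) i j) :
    (genStr K m q).sdeg (kontsevich K n m).bdeg = -2 * (q.wrap : ℤ) + m j - m i :=
  (sdeg_map_gen (kontsevich K n m) q).trans (q.sdeg_eq_wrap m)

theorem splits_genStr {i j : Fin n} (q : Str (XGen n) i j) : (genStr K m q).splits =
    q.splits.map fun s => ⟨s.1, genStr K m s.2.1, genStr K m s.2.2⟩ := splits_map _ q

theorem genVal_of_len_eq_zero {i j : Fin n} (w : Str (kontsevich K n m).B i j) (h : w.len = 0) :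
    genVal K m w = 0 := by
  cases w with
  | cons w a => simp [len] at h
  | nil =>
    rw [genVal_of_some (q := nil i) rfl]
    exact neg_eq_zero.2 (cElt_of_len_eq_zero K (nil i) rfl)

/-! ### The functor equation -/

variable (K m)

/-- The sum of all products of values of `F` and `G` at the parts of a string. -/
def prodSum {i j : Fin n}
    (F : ∀ {k : Fin n}, Str (kontsevich K n m).B k j → (Str (CGen n) k j →₀ K))
    (G : ∀ {k : Fin n}, Str (kontsevich K n m).B i k → (Str (CGen n) i k →₀ K))
    (p : Str (kontsevich K n m).B i j) : Str (CGen n) i j →₀ K :=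
  (p.splits.map fun s => (-1 : K) ^ (s.2.1.sdeg (kontsevich K n m).bdeg + 1) •
    freeComp (F s.2.2) (G s.2.1)).sum

theorem prodSum_add_add {i j : Fin n}
    (F F' : ∀ {k : Fin n}, Str (kontsevich K n m).B k j → (Str (CGen n) k j →₀ K))
    (G G' : ∀ {k : Fin n}, Str (kontsevich K n m).B i k → (Str (CGen n) i k →₀ K))
    (p : Str (kontsevich K n m).B i j) :
    prodSum K m (fun t => F t + F' t) (fun u => G u + G' u) p =
      prodSum K m F G p + prodSum K m F G' p + (prodSum K m F' G p + prodSum K m F' G' p) := by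
  simp only [prodSum, ← List.sum_map_add]
  refine congrArg List.sum (List.map_congr_left fun s _ => ?_)
  simp only [map_add, LinearMap.add_apply, smul_add]
  abel

/-- Only a final unit can be the left factor. The product with its image, an identity, is the
trailing term of the sum of insertions, so these cancel in the functor equation. -/
theorem prodSum_unitVal_left {i j : Fin n}
    (G : ∀ {k : Fin n}, Str (kontsevich K n m).B i k → (Str (CGen n) i k →₀ K))
    (p : Str (kontsevich K n m).B i j) :
    prodSum K m (fun t => unitVal K t) G p = (kontsevich K n m).trailVal p G := by
  cases p with
  | nil => simp [prodSum, splits, unitVal, trailVal]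
  | cons p a =>
    rw [prodSum, splits, List.map_cons, List.sum_cons, List.map_map, sum_splits_of_snd]
    · cases a with
      | e =>
        simp only [unitVal, Function.comp_apply, map_zero, LinearMap.zero_apply, smul_zero,
          zero_add, trailVal, freeComp_nil_left]
        rw [neg_one_zpow_neg (b := p.sdeg (kontsevich K n m).bdeg) (by omega), neg_smul]
      | gen a => simp [unitVal, trailVal]
    · intro s hs
      simp only [Function.comp_apply]
      rw [unitVal_of_len_ne_one, map_zero, LinearMap.zero_apply, smul_zero]
      simp only [len]
      omega

theorem prodSum_unitVal_right {i j : Fin n}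
    (F : ∀ {k : Fin n}, Str (kontsevich K n m).B k j → (Str (CGen n) k j →₀ K))
    (p : Str (kontsevich K n m).B i j) (hp : p.len ≠ 0) :
    prodSum K m F (fun u => unitVal K u) p = p.leadVal F := by
  obtain ⟨k, b, r, rfl⟩ := (eq_nil_or_one_append p).resolve_left hp
  rw [prodSum, sum_splits_of_fst_one]
  · simp only [sdeg_one]
    cases b with
    | e =>
      rw [leadVal_one_e_append]
      have h : (kontsevich K n m).bdeg (.e i) = 0 := rfl
      simp only [one, unitVal, freeComp_nil_right, h]
      simp
    | gen y =>
      rw [leadVal_one_gen_append]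
      simp [one, unitVal]
  · intro s hs
    rw [unitVal_of_len_ne_one _ hs, map_zero, smul_zero]

/-- Only the string `(e, e)` contributes on either side. -/
theorem linearCombination_unitVal_opU {i j : Fin n} (p : Str (kontsevich K n m).B i j) :
    Finsupp.linearCombination K (fun b => (unitVal K (one b) : Str (CGen n) i j →₀ K))
      ((kontsevich K n m).opU p) = (kontsevich K n m).trailVal p (unitVal K) := by
  match p with
  | .nil _ => simp [opU, trailVal]
  | .cons (.nil _) (.e _) => simp [opU, trailVal, unitVal]
  | .cons (.nil _) (.gen _) => simp [opU, trailVal]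
  | .cons (.cons (.nil _) (.e _)) (.e _) =>
    simp only [opU, trailVal, one, unitVal, Finsupp.linearCombination_single, one_smul, sdeg_cons,
      sdeg_nil]
    rw [neg_one_zpow_eq_neg_one (by simp [bdeg, UBasis.deg])]
    simp
  | .cons (.cons (.nil _) (.e _)) (.gen _) => simp [opU, trailVal, unitVal, one]
  | .cons (.cons (.nil _) (.gen _)) (.e _) => simp [opU, trailVal, unitVal, one]
  | .cons (.cons (.nil _) (.gen _)) (.gen _) => simp [opU, trailVal]
  | .cons (.cons (.cons _ _) _) (.e _) => simp [opU, trailVal, unitVal]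
  | .cons (.cons (.cons _ _) _) (.gen _) => simp [opU, trailVal]

theorem cD_unitVal {i j : Fin n} (p : Str (kontsevich K n m).B i j) :
    cD K m (unitVal K p) = 0 := by
  match p with
  | .nil _ => simp [unitVal]
  | .cons (.nil _) (.e _) => exact freeD_nil _
  | .cons (.nil _) (.gen _) => simp [unitVal]
  | .cons (.cons _ _) _ => simp [unitVal]

theorem prodSum_genVal_genVal_of_none {i j : Fin n} (p : Str (kontsevich K n m).B i j)
    (hp : p.toGen? = none) :
    prodSum K m (fun t => genVal K m t) (fun u => genVal K m u) p = 0 := by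
  rw [prodSum]
  refine List.sum_eq_zero ?_
  intro x hx
  obtain ⟨s, hs, rfl⟩ := List.mem_map.1 hx
  cases h1 : s.2.1.toGen? with
  | none => rw [genVal_of_none h1, map_zero, smul_zero]
  | some u =>
    cases h2 : s.2.2.toGen? with
    | none => rw [genVal_of_none h2, map_zero, LinearMap.zero_apply, smul_zero]
    | some t =>
      rw [← p.append_of_mem_splits s hs, eq_map_gen_of_toGen? h1, eq_map_gen_of_toGen? h2,
        ← map_append, toGen?_map_gen] at hp
      simp at hp

/-- This is the formula for `∂c^p_{ij}`: the quadratic part cancels the products of values of the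
functor, and the constant term is the image of `𝔪_n`. -/
theorem functor_eq_genStr {i j : Fin n} (q : Str (XGen n) i j) :
    (-1 : K) ^ ((genStr K m q).sdeg (kontsevich K n m).bdeg + 1) •
        cD K m (genVal K m (genStr K m q)) +
      prodSum K m (fun t => genVal K m t) (fun u => genVal K m u) (genStr K m q) =
    Finsupp.linearCombination K (fun b => (unitVal K (one b) : Str (CGen n) i j →₀ K))
      ((kontsevich K n m).m q) := by
  have h1 : prodSum K m (fun t => genVal K m t) (fun u => genVal K m u) (genStr K m q) =
      (q.splits.map fun s => (-1 : K) ^ (m j - m i + 1) • (-1 : K) ^ (m s.1 + m j) •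
        freeComp (cElt K s.2.2.wrap s.1 j) (cElt K s.2.1.wrap i s.1)).sum := by
    rw [prodSum, splits_genStr, List.map_map]
    refine congrArg List.sum (List.map_congr_left fun s _ => ?_)
    simp only [Function.comp_apply]
    rw [genVal_of_some (toGen?_genStr s.2.1), genVal_of_some (toGen?_genStr s.2.2), sdeg_genStr, smul_smul,
      neg_one_zpow_mul, map_neg, map_neg, LinearMap.neg_apply, neg_neg,
      neg_one_zpow_congr (show _ % 2 = (m j - m i + 1 + (m s.1 + m j)) % 2 by omega)]
  have h2 := sum_splits_cElt K m q
  have h3 : (q.splits.map fun s => (-1 : K) ^ (m j - m i + 1) • (-1 : K) ^ (m s.1 + m j) •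
        freeComp (cElt K s.2.2.wrap s.1 j) (cElt K s.2.1.wrap i s.1)).sum =
      (-1 : K) ^ (m j - m i + 1) • (q.splits.map fun s => (-1 : K) ^ (m s.1 + m j) •
        freeComp (cElt K s.2.2.wrap s.1 j) (cElt K s.2.1.wrap i s.1)).sum := by
    rw [List.smul_sum, List.map_map]
    rfl
  rw [h1, h3, h2, genVal_of_some (toGen?_genStr q), map_neg, cD_cElt, cDiff, sdeg_genStr,
    neg_one_zpow_congr (show _ % 2 = (m j - m i + 1) % 2 by omega), smul_neg, smul_add, neg_add,
    neg_add_cancel_right]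
  by_cases hq : q.len = n
  · obtain ⟨hw, rfl⟩ := (len_eq_card_iff q).1 hq
    rw [kontsevich_m_of_eq K m q hq rfl, if_pos hw, neg_one_zpow_eq_neg_one (by simp),
      freeDelta_self]
    simp [UBasis.ofEq, one, unitVal]
  · rw [kontsevich_m_of_ne K m q hq, map_zero]
    by_cases hw : q.wrap = 1
    · rw [freeDelta_of_ne K (fun hij => hq ((len_eq_card_iff q).2 ⟨hw, hij⟩)), ite_self, smul_zero,
        neg_zero]
    · rw [if_neg hw, smul_zero, neg_zero]

/-- With `F = genVal + unitVal` expanded, the products involving `unitVal` match the leading and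
trailing terms of the insertions and the products of units. What remains is the case without units.
-/
theorem functor_eq {i j : Fin n} (p : Str (kontsevich K n m).B i j) (hp : p.len ≠ 0) :
    (-1 : K) ^ (p.sdeg (kontsevich K n m).bdeg + 1) • cD K m (genVal K m p + unitVal K p) +
      prodSum K m (fun t => genVal K m t + unitVal K t) (fun u => genVal K m u + unitVal K u) p =
    insertSum (kontsevich K n m).op (fun w => genVal K m w + unitVal K w) p := by
  rw [map_add (cD K m), cD_unitVal, add_zero, insertSum_add,
    insertSum_op_eq (kontsevich_m_gen K m) _ (fun w => genVal_of_none),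
    insertSum_of_len_ne_one _ unitVal_of_len_ne_one p hp, op_eq,
    map_add (Finsupp.linearCombination K _), linearCombination_unitVal_opU, prodSum_add_add,
    prodSum_unitVal_left, prodSum_unitVal_left,
    prodSum_unitVal_right K m _ p hp]
  have key : (-1 : K) ^ (p.sdeg (kontsevich K n m).bdeg + 1) • cD K m (genVal K m p) +
      prodSum K m (fun t => genVal K m t) (fun u => genVal K m u) p =
      Finsupp.linearCombination K (fun b => (unitVal K (one b) : Str (CGen n) i j →₀ K))
        ((kontsevich K n m).opC p) := by
    cases h : p.toGen? with
    | none =>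
      rw [prodSum_genVal_genVal_of_none K m p h, genVal_of_none h, opC_of_none h, map_zero,
        map_zero, smul_zero, add_zero]
    | some q =>
      rw [opC_of_some h, eq_genStr h]
      exact functor_eq_genStr K m q
  rw [← key]
  abel

theorem prodSum_eq_sum₂ {i j : Fin n}
    (F : ∀ {k l : Fin n}, Str (kontsevich K n m).B k l → (Str (CGen n) k l →₀ K))
    (hF : ∀ {k l : Fin n} (w : Str (kontsevich K n m).B k l), w.len = 0 → F w = 0)
    (p : Str (kontsevich K n m).B i j) :
    p.sum₂ (fun u t _ _ => (-1 : K) ^ (u.sdeg (kontsevich K n m).bdeg + 1) •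
      freeComp (F t) (F u)) = prodSum K m F F p := by
  rw [sum₂, prodSum]
  refine congrArg List.sum (List.map_congr_left fun s _ => ?_)
  split_ifs with h
  · rfl
  · rw [not_and_or, not_not, not_not] at h
    rcases h with h | h
    · rw [hF _ h, map_zero, smul_zero]
    · rw [hF _ h, map_zero, LinearMap.zero_apply, smul_zero]

theorem functor_mem {i j : Fin n} (p : Str (kontsevich K n m).B i j) :
    genVal K m p + unitVal K p ∈ Finsupp.supported K K {w : Str (CGen n) i j |
      w.deg (fun {_ _} p => cDeg m p) = p.sdeg (kontsevich K n m).bdeg + 1} := by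
  refine add_mem ?_ ?_
  · cases h : p.toGen? with
    | none => rw [genVal_of_none h]; exact zero_mem _
    | some q =>
      obtain ⟨q, h⟩ : ∃ q : Str (XGen n) i j, p.toGen? = some q := ⟨q, h⟩
      rw [genVal_of_some h, eq_genStr h, sdeg_genStr,
        show -2 * (q.wrap : ℤ) + m j - m i + 1 = 1 - 2 * (q.wrap : ℤ) + m j - m i by ring]
      exact neg_mem (cElt_mem K m _ i j)
  · match p with
    | .nil _ => exact zero_mem _
    | .cons (.nil _) (.e _) =>
      refine Finsupp.single_mem_supported _ _ ?_
      simp [sdeg_cons, sdeg_nil, Str.deg, bdeg, UBasis.deg]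
    | .cons (.nil _) (.gen _) => exact zero_mem _
    | .cons (.cons _ _) _ => exact zero_mem _

theorem functor_unit (i : Fin n) : genVal K m (one (.e i)) +
      unitVal K (one (.e i) : Str (kontsevich K n m).B i i) =
    Finsupp.single (nil i : Str (CGen n) i i) 1 := by
  rw [genVal_of_none rfl, zero_add]
  rfl

theorem functor_unit_higher {i j k : Fin n} (u : Str (kontsevich K n m).B i j)
    (t : Str (kontsevich K n m).B j k) (h : u.len + t.len ≠ 0) :
    genVal K m (u.insert (.e j) t) + unitVal K (u.insert (.e j) t) = 0 := by
  rw [genVal_of_none (toGen?_insert_e u t), zero_add]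
  refine unitVal_of_len_ne_one _ ?_
  simp only [Str.insert, len_append, len]
  omega

/-- The A∞-functor from Kontsevich's category to the internal DG-category. -/
def internalFunctor : AInfFunctor (kontsevich K n m) (internalDG K n m) where
  F p := genVal K m p + unitVal K p
  F_deg p _ := functor_mem K m p
  F_eq p hp := by
    refine Eq.trans ?_ (functor_eq K m p hp)
    rw [← prodSum_eq_sum₂ K m (fun w => genVal K m w + unitVal K w)]
    · rfl
    · intro k l w hw
      rw [genVal_of_len_eq_zero w hw, unitVal_of_len_ne_one w (by omega), add_zero]
  F_unit := functor_unit K m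
  F_unit_higher := functor_unit_higher K m

end Functor

/-! ### A contracting homotopy on the internal DG-category -/

section Homotopy

open Finset (range)

variable {n : ℕ}

/-- The length of the path on the circle that corresponds to the generator `c^p_{ij}`. -/
def cLen {i j : Fin n} (a : CGen n i j) : ℤ := (a.1 : ℤ) * n + (j : ℕ) - (i : ℕ)

theorem winding_pos {p : ℕ} {i j : Fin n} (h : 1 ≤ p ∨ i < j) :
    0 < (p : ℤ) * n + (j : ℕ) - (i : ℕ) := by
  have hi := i.2
  rcases h with h | h
  · have h1 : 1 * n ≤ p * n := Nat.mul_le_mul_right n h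
    have h2 : ((1 * n : ℕ) : ℤ) ≤ ((p * n : ℕ) : ℤ) := by exact_mod_cast h1
    push_cast at h2
    omega
  · have h1 := Fin.lt_def.1 h
    have h2 : (0 : ℤ) ≤ (p : ℤ) * n := by positivity
    omega

theorem cLen_pos {i j : Fin n} (a : CGen n i j) : 0 < cLen a := winding_pos a.2

/-- The total length of a string of generators. -/
def Str.totalLen {i j : Fin n} : Str (CGen n) i j → ℤ
  | nil _ => 0
  | cons p a => totalLen p + cLen a

theorem Str.totalLen_nonneg {i j : Fin n} (p : Str (CGen n) i j) : 0 ≤ p.totalLen := by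
  induction p with
  | nil => exact le_rfl
  | cons p a ih => have := cLen_pos a; simp only [totalLen]; omega

/-- The generator `c^{q+p}_{ij}` obtained from `c^p_{rj}` and `c^q_{ir}`. -/
def cMerge {i r j : Fin n} (b : CGen n i r) (a : CGen n r j) : CGen n i j :=
  ⟨a.1 + b.1, by
    rcases a.2 with h | h
    · exact Or.inl (by omega)
    · rcases b.2 with h' | h'
      · exact Or.inl (by omega)
      · exact Or.inr (h'.trans h)⟩

theorem cLen_cMerge {i r j : Fin n} (b : CGen n i r) (a : CGen n r j) :
    cLen (cMerge b a) = cLen b + cLen a := by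
  simp only [cLen, cMerge]
  push_cast
  ring

variable (K : Type u) [Field K] (m : Fin n → ℤ)

/-- The homotopy on strings: if the last generator has length one, it is merged with the one before
it. -/
def homotopyStr {i j : Fin n} : Str (CGen n) i j → (Str (CGen n) i j →₀ K)
  | .cons (Y := r) (.cons p b) a =>
    if cLen a = 1 then Finsupp.single (p.cons (cMerge b a)) ((-1 : K) ^ (m r + m j)) else 0
  | _ => 0

/-- The contracting homotopy. -/
def homotopy (i j : Fin n) : (Str (CGen n) i j →₀ K) →ₗ[K] (Str (CGen n) i j →₀ K) :=
  Finsupp.linearCombination K (homotopyStr K m)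

theorem homotopy_single {i j : Fin n} (p : Str (CGen n) i j) (c : K) :
    homotopy K m i j (Finsupp.single p c) = c • homotopyStr K m p :=
  Finsupp.linearCombination_single _ _ _

theorem homotopy_comp_of_cLen_ne_one {i r j : Fin n} (a : CGen n r j) (ha : cLen a ≠ 1)
    (y : Str (CGen n) i r →₀ K) :
    homotopy K m i j (freeComp (Finsupp.single (Str.one a) 1) y) = 0 := by
  induction y using Finsupp.induction_linear with
  | zero => simp
  | add f g hf hg => rw [map_add, map_add, hf, hg, add_zero]
  | single p c =>
    rw [← single_cons, homotopy_single]
    cases p with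
    | nil => simp [homotopyStr]
    | cons p b => simp [homotopyStr, ha]

theorem homotopy_comp_comp {i k r j : Fin n} (a : CGen n r j) (ha : cLen a = 1) (b : CGen n k r)
    (y : Str (CGen n) i k →₀ K) :
    homotopy K m i j (freeComp (Finsupp.single (Str.one a) 1)
        (freeComp (Finsupp.single (Str.one b) 1) y)) =
      (-1 : K) ^ (m r + m j) • freeComp (Finsupp.single (Str.one (cMerge b a)) 1) y := by
  induction y using Finsupp.induction_linear with
  | zero => simp
  | add f g hf hg => simp only [map_add, hf, hg, smul_add]
  | single p c =>
    rw [← single_cons, ← single_cons, ← single_cons, homotopy_single]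
    simp [homotopyStr, ha, mul_comm]

theorem homotopy_comp_cElt {i k r j : Fin n} (a : CGen n r j) (ha : cLen a = 1) (q : ℕ)
    (y : Str (CGen n) i k →₀ K) :
    homotopy K m i j (freeComp (Finsupp.single (Str.one a) 1) (freeComp (cElt K q k r) y)) =
      if 1 ≤ q ∨ k < r then (-1 : K) ^ (m r + m j) • freeComp (cElt K (a.1 + q) k j) y else 0 := by
  split_ifs with h
  · have h1 : cElt K (a.1 + q) k j = Finsupp.single (Str.one (cMerge ⟨q, h⟩ a)) 1 :=
      cElt_of_valid K (cMerge ⟨q, h⟩ a).2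
    rw [cElt_of_valid K h, homotopy_comp_comp K m a ha, h1]
  · rw [cElt_of_not_valid K h, map_zero, LinearMap.zero_apply, map_zero, map_zero]

/-- The span of the strings of total length less than `N`. -/
abbrev shortStr (i j : Fin n) (N : ℤ) : Submodule K (Str (CGen n) i j →₀ K) :=
  Finsupp.supported K K {w : Str (CGen n) i j | w.totalLen < N}

theorem single_mem_shortStr {i j : Fin n} {N : ℤ} {p : Str (CGen n) i j} (hp : p.totalLen < N)
    (c : K) : Finsupp.single p c ∈ shortStr K i j N := Finsupp.single_mem_supported _ _ hp

theorem shortStr_induction {i j : Fin n} {N : ℤ} {E : Type*} [AddCommGroup E] [Module K E]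
    (f : (Str (CGen n) i j →₀ K) →ₗ[K] E) (S : Submodule K E)
    (hf : ∀ p : Str (CGen n) i j, p.totalLen < N → f (Finsupp.single p 1) ∈ S)
    {y : Str (CGen n) i j →₀ K} (hy : y ∈ shortStr K i j N) : f y ∈ S := by
  rw [shortStr, Finsupp.supported_eq_span_single] at hy
  induction hy using Submodule.span_induction with
  | zero => rw [map_zero]; exact zero_mem _
  | add a b _ _ ha hb => rw [map_add]; exact add_mem ha hb
  | smul c a _ ha => rw [map_smul]; exact Submodule.smul_mem _ _ ha
  | mem y hy =>
    obtain ⟨p, hp, rfl⟩ := hy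
    exact hf p hp

/-- Merging two generators adds their lengths, so the total length is unchanged. -/
theorem homotopy_mem {i j : Fin n} {N : ℤ} {y : Str (CGen n) i j →₀ K}
    (hy : y ∈ shortStr K i j N) : homotopy K m i j y ∈ shortStr K i j N := by
  refine shortStr_induction K (homotopy K m i j) _ (fun p hp => ?_) hy
  rw [homotopy_single, one_smul]
  match p with
  | .nil _ => exact zero_mem _
  | .cons (.nil _) _ => exact zero_mem _
  | .cons (.cons p b) a =>
    simp only [homotopyStr]
    split_ifs
    · refine single_mem_shortStr K ?_ _
      simp only [Str.totalLen, cLen_cMerge] at hp ⊢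
      omega
    · exact zero_mem _

theorem comp_freeDelta_mem {i r j : Fin n} {N : ℤ} (p : Str (CGen n) i r) (hp : p.totalLen < N) :
    freeComp (freeDelta r j) (Finsupp.single p (1 : K)) ∈ shortStr K i j N := by
  by_cases h : r = j
  · subst h
    rw [freeDelta_self, freeComp_nil_left]
    exact single_mem_shortStr K hp 1
  · rw [freeDelta_of_ne K h, map_zero, LinearMap.zero_apply]
    exact zero_mem _

/-- The differential of a generator, split according to the length of the left factor. -/
theorem cDiff_eq_of_cLen_one {s p : ℕ} {k r j : Fin n}
    (h : (s : ℤ) * n + (j : ℕ) - (r : ℕ) = 1) :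
    cDiff K m (s + p) k j = (if s + p = 1 then freeDelta k j else 0) +
      ((-1 : K) ^ (m r + m j) • freeComp (cElt K s r j) (cElt K p k r) +
        ∑ q ∈ range (p + 1), ∑ t : Fin n, if 1 ≤ p - q ∨ t < r then
          (-1 : K) ^ (m t + m j) • freeComp (cElt K (s + p - q) t j) (cElt K q k t) else 0) := by
  let G : ℕ → Fin n → (Str (CGen n) k j →₀ K) := fun q t =>
    (-1 : K) ^ (m t + m j) • freeComp (cElt K (s + p - q) t j) (cElt K q k t)
  have h1 := sum_splittings_succ G (p := p) h
  have h2 : ∀ q t, (if 1 ≤ s + p - q ∨ t < j then G q t else 0) = G q t := by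
    intro q t
    refine ite_eq_left_iff.2 fun h => ?_
    simp only [G]
    rw [cElt_of_not_valid K h, map_zero, LinearMap.zero_apply, smul_zero]
  simp only [h2] at h1
  have h3 : G p r = (-1 : K) ^ (m r + m j) • freeComp (cElt K s r j) (cElt K p k r) := by
    simp only [G, Nat.add_sub_cancel]
  rw [cDiff, h1, h3]

/-- A quadratic term would have two factors of positive length adding up to one. -/
theorem cDiff_of_cLen_one {r j : Fin n} (a : CGen n r j) (ha : cLen a = 1) :
    cDiff K m a.1 r j = if a.1 = 1 then freeDelta r j else 0 := by
  rw [cDiff]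
  refine add_eq_left.2 (Finset.sum_eq_zero fun q hq => Finset.sum_eq_zero fun t _ => ?_)
  by_cases h1 : 1 ≤ q ∨ r < t
  · by_cases h2 : 1 ≤ a.1 - q ∨ t < j
    · exfalso
      have h3 := winding_pos h1
      have h4 := winding_pos h2
      rw [Finset.mem_range] at hq
      rw [Nat.cast_sub (by omega), sub_mul] at h4
      rw [cLen] at ha
      omega
    · rw [cElt_of_not_valid K h2, map_zero, LinearMap.zero_apply, smul_zero]
  · rw [cElt_of_not_valid K h1, map_zero, smul_zero]

theorem exists_winding_one (j : Fin n) :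
    ∃ (s : ℕ) (r : Fin n), (s : ℤ) * n + (j : ℕ) - (r : ℕ) = 1 := by
  have hj := j.2
  by_cases h : (j : ℕ) = 0
  · refine ⟨1, ⟨n - 1, by omega⟩, ?_⟩
    simp only [h]
    push_cast
    omega
  · refine ⟨0, ⟨j - 1, by omega⟩, ?_⟩
    push_cast
    omega

/-- The homotopy identity for a string whose last generator has length at least two. -/
theorem homotopy_identity_long {i k j : Fin n} (p : Str (CGen n) i k) (a : CGen n k j)
    (ha : cLen a ≠ 1) :
    cD K m (homotopy K m i j (Finsupp.single (p.cons a) 1)) +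
      homotopy K m i j (cD K m (Finsupp.single (p.cons a) 1)) - Finsupp.single (p.cons a) 1 ∈
    shortStr K i j (p.cons a).totalLen := by
  obtain ⟨s, r, hs⟩ := exists_winding_one j
  have hpos := cLen_pos a
  have hcases := winding_one_cases hs
  -- The length-one arrow into `j` wraps only if `j` is the first object, and then `a` wraps as
  -- well. The number `q` is the winding number of what is left of `a`; by `hqv` this remainder is
  -- non-empty.
  obtain ⟨q, hq⟩ : ∃ q, a.1 = s + q := by
    refine Nat.exists_eq_add_of_le ?_
    rcases hcases with ⟨rfl, -⟩ | ⟨rfl, hj, -⟩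
    · exact Nat.zero_le _
    · rcases a.2 with h | h
      · exact h
      · rw [Fin.lt_def] at h; omega
  have hsv : 1 ≤ s ∨ r < j := by
    rcases hcases with ⟨-, h⟩ | ⟨h, -⟩
    · exact Or.inr (by rw [Fin.lt_def]; omega)
    · exact Or.inl h.ge
  have hqv : 1 ≤ q ∨ k < r := by
    rw [cLen, hq] at ha hpos
    push_cast at ha hpos
    rw [add_mul] at ha hpos
    by_contra hcon
    rw [not_or, Fin.lt_def] at hcon
    have : q = 0 := by omega
    subst this
    simp only [Nat.cast_zero, zero_mul] at ha hpos
    omega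
  have h1 : homotopy K m i j (freeComp (cDiff K m a.1 k j) (Finsupp.single p 1)) =
      homotopy K m i j (freeComp (if a.1 = 1 then freeDelta k j else 0) (Finsupp.single p 1)) +
        Finsupp.single (p.cons a) 1 := by
    rw [hq, cDiff_eq_of_cLen_one K m hs]
    simp only [map_add, LinearMap.add_apply, map_smul, LinearMap.smul_apply, freeComp_assoc]
    congr 1
    -- The term of `∂a` whose left factor has length one is merged back to `a`, with the square of a
    -- sign. All other quadratic terms have a longer left factor and are killed by the homotopy.
    rw [cElt_of_valid K hsv, homotopy_comp_cElt K m ⟨s, hsv⟩ hs, if_pos hqv, smul_smul,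
      neg_one_zpow_mul, neg_one_zpow_eq_one (by omega), one_smul, map_sum, LinearMap.sum_apply,
      map_sum, Finset.sum_eq_zero, add_zero]
    · rw [single_cons, ← hq, cElt_of_valid K a.2]
    · intro q' hq'
      rw [map_sum, LinearMap.sum_apply, map_sum]
      refine Finset.sum_eq_zero fun t _ => ?_
      split_ifs with ht
      · rw [map_smul, LinearMap.smul_apply, map_smul, freeComp_assoc]
        refine smul_eq_zero_of_right _ ?_
        rw [Finset.mem_range] at hq'
        by_cases htv : 1 ≤ s + q - q' ∨ t < j
        · rw [cElt_of_valid K htv]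
          refine homotopy_comp_of_cLen_ne_one K m _ ?_ _
          have h2 := winding_pos ht
          rw [Nat.cast_sub (by omega), sub_mul] at h2
          simp only [cLen]
          rw [Nat.cast_sub (by omega), sub_mul]
          push_cast
          rw [add_mul]
          omega
        · rw [cElt_of_not_valid K htv, map_zero, LinearMap.zero_apply, map_zero]
      · rw [map_zero, LinearMap.zero_apply, map_zero]
  have h2 : homotopy K m i j (Finsupp.single (p.cons a) 1) = 0 := by
    rw [single_cons, homotopy_comp_of_cLen_ne_one K m a ha]
  have h3 : homotopy K m i j (cD K m (Finsupp.single (p.cons a) 1)) =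
      homotopy K m i j (freeComp (cDiff K m a.1 k j) (Finsupp.single p 1)) := by
    rw [single_cons, freeD_comp_one, map_add, map_smul, homotopy_comp_of_cLen_ne_one K m a ha,
      smul_zero, add_zero]
  rw [h2, h3, h1, map_zero, zero_add, add_sub_cancel_right]
  refine homotopy_mem K m ?_
  split_ifs
  · refine comp_freeDelta_mem K p ?_
    simp only [Str.totalLen]
    omega
  · rw [map_zero, LinearMap.zero_apply]
    exact zero_mem _

/-- The homotopy identity for a string whose last generator has length one. -/
theorem homotopy_identity_short {i k r j : Fin n} (p : Str (CGen n) i k) (b : CGen n k r)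
    (a : CGen n r j) (ha : cLen a = 1) :
    cD K m (homotopy K m i j (Finsupp.single ((p.cons b).cons a) 1)) +
      homotopy K m i j (cD K m (Finsupp.single ((p.cons b).cons a) 1)) -
        Finsupp.single ((p.cons b).cons a) 1 ∈
    shortStr K i j ((p.cons b).cons a).totalLen := by
  have hb := cLen_pos b
  set P : Str (CGen n) i k →₀ K := Finsupp.single p 1 with hP
  set a₁ : Str (CGen n) r j →₀ K := Finsupp.single (Str.one a) 1 with ha₁
  set b₁ : Str (CGen n) k r →₀ K := Finsupp.single (Str.one b) 1 with hb₁
  -- `S` collects the terms of the differential of the merged generator whose left factor is longer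
  -- than `a`. The same terms arise from `a ∂b` after merging `a` into the left factor, with the
  -- opposite sign.
  set S : Str (CGen n) i j →₀ K := ∑ q ∈ range (b.1 + 1), ∑ t : Fin n,
    if 1 ≤ b.1 - q ∨ t < r then
      (-1 : K) ^ (m t + m j) • freeComp (cElt K (a.1 + b.1 - q) t j) (freeComp (cElt K q k t) P)
    else 0 with hS
  have hae : cElt K a.1 r j = a₁ := cElt_of_valid K a.2
  have hbe : cElt K b.1 k r = b₁ := cElt_of_valid K b.2
  have hw : Finsupp.single ((p.cons b).cons a) (1 : K) = freeComp a₁ (freeComp b₁ P) := by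
    rw [single_cons, single_cons]
  have h1 : homotopy K m i j (freeComp a₁ (freeComp b₁ P)) =
      (-1 : K) ^ (m r + m j) • freeComp (Finsupp.single (Str.one (cMerge b a)) 1) P :=
    homotopy_comp_comp K m a ha b P
  have h2 : cD K m (homotopy K m i j (freeComp a₁ (freeComp b₁ P))) =
      (-1 : K) ^ (m r + m j) •
        freeComp (if a.1 + b.1 = 1 then freeDelta k j else 0) P +
      freeComp a₁ (freeComp b₁ P) + (-1 : K) ^ (m r + m j) • S +
      (-1 : K) ^ (1 + m r - m k) •
        freeComp (Finsupp.single (Str.one (cMerge b a)) 1) (cD K m P) := by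
    rw [h1, map_smul, freeD_comp_one]
    change _ • (freeComp (cDiff K m (a.1 + b.1) k j) P + _) = _
    rw [cDiff_eq_of_cLen_one K m ha, hae, hbe]
    simp only [map_add, LinearMap.add_apply, map_smul, LinearMap.smul_apply, freeComp_assoc,
      smul_add, smul_smul, neg_one_zpow_mul]
    rw [neg_one_zpow_eq_one (a := m r + m j + (m r + m j)) (by omega), one_smul,
      neg_one_zpow_congr (show (m r + m j + (1 - 2 * ((cMerge b a).1 : ℤ) + m j - m k)) % 2 =
        (1 + m r - m k) % 2 by omega)]
    have h3 : (freeComp (∑ q ∈ range (b.1 + 1), ∑ t : Fin n, if 1 ≤ b.1 - q ∨ t < r then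
          (-1 : K) ^ (m t + m j) • freeComp (cElt K (a.1 + b.1 - q) t j) (cElt K q k t) else 0)) P =
        S := by
      simp only [hS, map_sum, LinearMap.sum_apply]
      refine Finset.sum_congr rfl fun q _ => Finset.sum_congr rfl fun t _ => ?_
      split_ifs
      · rw [map_smul, LinearMap.smul_apply, freeComp_assoc]
      · rw [map_zero, LinearMap.zero_apply]
    rw [h3]
    abel
  have h4 : homotopy K m i j (freeComp a₁ (freeComp (cDiff K m b.1 k r) P)) =
      homotopy K m i j (freeComp a₁ (freeComp (if b.1 = 1 then freeDelta k r else 0) P)) + S := by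
    rw [cDiff]
    simp only [map_add, LinearMap.add_apply, map_sum, LinearMap.sum_apply, map_smul,
      LinearMap.smul_apply, freeComp_assoc]
    congr 1
    rw [hS]
    refine Finset.sum_congr rfl fun q hq => Finset.sum_congr rfl fun t _ => ?_
    rw [homotopy_comp_cElt K m a ha]
    split_ifs
    · rw [smul_smul, neg_one_zpow_mul, Finset.mem_range] at *
      rw [neg_one_zpow_congr (show _ % 2 = (m t + m j) % 2 by omega),
        show a.1 + (b.1 - q) = a.1 + b.1 - q by omega]
    · rw [smul_zero]
  have h5 : homotopy K m i j (cD K m (freeComp a₁ (freeComp b₁ P))) =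
      homotopy K m i j (freeComp (if a.1 = 1 then freeDelta r j else 0) (freeComp b₁ P)) +
      (-1 : K) ^ (1 + m r + m j) •
        homotopy K m i j (freeComp a₁ (freeComp (if b.1 = 1 then freeDelta k r else 0) P)) -
      (-1 : K) ^ (m r + m j) • S -
      (-1 : K) ^ (1 + m r - m k) •
        freeComp (Finsupp.single (Str.one (cMerge b a)) 1) (cD K m P) := by
    rw [freeD_comp_one, freeD_comp_one, cDiff_of_cLen_one K m a ha]
    simp only [map_add, map_smul]
    rw [h4, homotopy_comp_comp K m a ha b, smul_add, smul_add, smul_smul, smul_smul,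
      neg_one_zpow_mul, neg_one_zpow_mul,
      neg_one_zpow_congr (show (1 - 2 * (a.1 : ℤ) + m j - m r) % 2 = (1 + m r + m j) % 2 by omega),
      neg_one_zpow_neg (show (cDeg m a + cDeg m b + (m r + m j)) % 2 ≠ (1 + m r - m k) % 2 by
        rw [show cDeg m a + cDeg m b + (m r + m j) =
          m r - m k + 2 * (1 - (a.1 : ℤ) - b.1 + m j) by ring]
        omega)]
    have h6 : (-1 : K) ^ (1 + m r + m j) • S = -((-1 : K) ^ (m r + m j) • S) := by
      rw [neg_one_zpow_neg (show (1 + m r + m j) % 2 ≠ (m r + m j) % 2 by omega), neg_smul]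
    rw [h6, neg_smul]
    abel
  rw [hw, h2, h5]
  -- After cancellation there remain three terms coming from the constants in the differentials of
  -- the merged generator, of `a` and of `b`; all are shorter.
  have h7 : ∀ x₀ w s d x₁ x₂ : Str (CGen n) i j →₀ K,
      x₀ + w + s + d + (x₁ + x₂ - s - d) - w = x₀ + x₁ + x₂ := by
    intros; abel
  rw [h7]
  refine add_mem (add_mem (Submodule.smul_mem _ _ ?_) (homotopy_mem K m ?_))
    (Submodule.smul_mem _ _ (homotopy_mem K m ?_))
  · split_ifs
    · refine comp_freeDelta_mem K p ?_
      simp only [Str.totalLen]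
      omega
    · rw [map_zero, LinearMap.zero_apply]
      exact zero_mem _
  · rw [hb₁, hP, ← single_cons]
    split_ifs
    · refine comp_freeDelta_mem K _ ?_
      simp only [Str.totalLen]
      omega
    · rw [map_zero, LinearMap.zero_apply]
      exact zero_mem _
  · by_cases h : b.1 = 1 ∧ k = r
    · obtain ⟨h, rfl⟩ := h
      rw [if_pos h, freeDelta_self, freeComp_nil_left, ha₁, hP, ← single_cons]
      refine single_mem_shortStr K ?_ 1
      simp only [Str.totalLen]
      omega
    · have h0 : (if b.1 = 1 then freeDelta k r else 0 : Str (CGen n) k r →₀ K) = 0 := by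
        split_ifs with h'
        · exact freeDelta_of_ne K fun h'' => h ⟨h', h''⟩
        · rfl
      rw [h0, map_zero, LinearMap.zero_apply, map_zero]
      exact zero_mem _

theorem homotopy_identity {i j : Fin n} (p : Str (CGen n) i j) (hp : 2 ≤ p.totalLen) :
    cD K m (homotopy K m i j (Finsupp.single p 1)) +
      homotopy K m i j (cD K m (Finsupp.single p 1)) - Finsupp.single p 1 ∈
    shortStr K i j p.totalLen := by
  match p with
  | .nil _ => simp [Str.totalLen] at hp
  | .cons (.nil _) a =>
    refine homotopy_identity_long K m _ a fun h => ?_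
    simp only [Str.totalLen] at hp
    omega
  | .cons (.cons p b) a =>
    by_cases h : cLen a = 1
    · exact homotopy_identity_short K m p b a h
    · exact homotopy_identity_long K m _ a h

end Homotopy

/-! ### The functor is a quasi-isomorphism -/

section QuasiIso

open AInfCat Str

variable (K : Type u) [Field K] {n : ℕ} (m : Fin n → ℤ)

theorem cD_cD {i j : Fin n} (y : Str (CGen n) i j →₀ K) : cD K m (cD K m y) = 0 :=
  freeD_freeD (fun _ => cDiff_mem K m _ _ _) (fun _ => cD_cDiff K m _ _ _) y

theorem homotopyStr_of_totalLen_lt_two {i j : Fin n} (p : Str (CGen n) i j)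
    (hp : p.totalLen < 2) : homotopyStr K m p = 0 := by
  match p with
  | .nil _ => rfl
  | .cons (.nil _) _ => rfl
  | .cons (.cons p b) a =>
    have h1 := cLen_pos a
    have h2 := cLen_pos b
    have h3 := p.totalLen_nonneg
    simp only [totalLen] at hp
    omega

theorem homotopy_of_mem_shortStr_two {i j : Fin n} {y : Str (CGen n) i j →₀ K}
    (hy : y ∈ shortStr K i j 2) : homotopy K m i j y = 0 := by
  rw [← Submodule.mem_bot K]
  refine shortStr_induction K (homotopy K m i j) ⊥ (fun p hp => ?_) hy
  rw [homotopy_single, homotopyStr_of_totalLen_lt_two K m p hp, smul_zero]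
  exact zero_mem _

/-- Strings of total length at most one. -/
theorem eq_nil_or_one_of_totalLen_lt_two {i j : Fin n} (p : Str (CGen n) i j)
    (hp : p.totalLen < 2) : (∃ h : i = j, p = ofEq h) ∨ ∃ a, cLen a = 1 ∧ p = one a := by
  match p with
  | .nil _ => exact Or.inl ⟨rfl, rfl⟩
  | .cons (.nil _) a =>
    have h := cLen_pos a
    simp only [totalLen] at hp
    exact Or.inr ⟨a, by omega, rfl⟩
  | .cons (.cons p b) a =>
    have h1 := cLen_pos a
    have h2 := cLen_pos b
    have h3 := p.totalLen_nonneg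
    simp only [totalLen] at hp
    omega

theorem cD_mem_shortStr_two {i j : Fin n} {y : Str (CGen n) i j →₀ K}
    (hy : y ∈ shortStr K i j 2) : cD K m y ∈ shortStr K i j 2 := by
  refine shortStr_induction K (cD K m) _ (fun p hp => ?_) hy
  rcases eq_nil_or_one_of_totalLen_lt_two p hp with ⟨rfl, rfl⟩ | ⟨a, ha, rfl⟩
  · rw [show ofEq rfl = nil i from rfl, freeD_nil]
    exact zero_mem _
  · rw [freeD_one, cDiff_of_cLen_one K m a ha]
    split_ifs
    · by_cases h : i = j
      · subst h
        rw [freeDelta_self]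
        exact single_mem_shortStr K (by simp [totalLen]) 1
      · rw [freeDelta_of_ne K h]
        exact zero_mem _
    · exact zero_mem _

/-- On strings of length at least two the homotopy identity drops the length. On shorter strings the
operator is `-id`, which is harmless because `N ≥ 2`. -/
theorem homotopy_reduce {i j : Fin n} {N : ℤ} (hN : 2 ≤ N) {y : Str (CGen n) i j →₀ K}
    (hy : y ∈ shortStr K i j (N + 1)) :
    cD K m (homotopy K m i j y) + homotopy K m i j (cD K m y) - y ∈ shortStr K i j N := by
  let T : (Str (CGen n) i j →₀ K) →ₗ[K] (Str (CGen n) i j →₀ K) :=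
    cD K m ∘ₗ homotopy K m i j + homotopy K m i j ∘ₗ cD K m - LinearMap.id
  change T y ∈ _
  refine shortStr_induction K T _ (fun p hp => ?_) hy
  change cD K m (homotopy K m i j (Finsupp.single p 1)) +
      homotopy K m i j (cD K m (Finsupp.single p 1)) - Finsupp.single p 1 ∈ _
  by_cases h : 2 ≤ p.totalLen
  · refine Finsupp.supported_mono ?_ (homotopy_identity K m p h)
    intro w hw
    simp only [Set.mem_ofPred_eq] at hw ⊢
    omega
  · have hs : Finsupp.single p (1 : K) ∈ shortStr K i j 2 := single_mem_shortStr K (by omega) 1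
    rw [homotopy_of_mem_shortStr_two K m hs,
      homotopy_of_mem_shortStr_two K m (cD_mem_shortStr_two K m hs), map_zero, zero_add, zero_sub]
    exact neg_mem (single_mem_shortStr K (by omega) 1)

theorem exists_mem_shortStr {i j : Fin n} (y : Str (CGen n) i j →₀ K) :
    ∃ N : ℕ, y ∈ shortStr K i j (2 + N) := by
  induction y using Finsupp.induction_linear with
  | zero => exact ⟨0, zero_mem _⟩
  | add f g hf hg =>
    obtain ⟨N, hN⟩ := hf
    obtain ⟨N', hN'⟩ := hg
    refine ⟨N + N', add_mem (Finsupp.supported_mono ?_ hN) (Finsupp.supported_mono ?_ hN')⟩ <;>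
    · intro w hw
      simp only [Set.mem_ofPred_eq] at hw ⊢
      push_cast
      omega
  | single p c =>
    exact ⟨p.totalLen.toNat, single_mem_shortStr K (by have := p.totalLen_nonneg; omega) c⟩

/-- Every cycle is homologous to one in the span of the strings of length at most one. -/
theorem exists_short_cycle {i j : Fin n} (y : Str (CGen n) i j →₀ K) (hy : cD K m y = 0) :
    ∃ y₀ ∈ shortStr K i j 2, ∃ z, y = y₀ + cD K m z := by
  obtain ⟨N, hN⟩ := exists_mem_shortStr K y
  induction N generalizing y with
  | zero => exact ⟨y, by simpa using hN, 0, by rw [map_zero, add_zero]⟩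
  | succ N ih =>
    have h1 := homotopy_reduce K m (N := 2 + N) (by omega)
      (by rw [add_assoc]; exact_mod_cast hN)
    rw [hy, map_zero, add_zero] at h1
    -- The induction hypothesis is applied to the shorter cycle `∂hy - y`, which is homologous to
    -- `-y`.
    obtain ⟨y₀, hy₀, z, hz⟩ := ih _ (by rw [map_sub, cD_cD, hy, sub_zero]) h1
    refine ⟨-y₀, neg_mem hy₀, homotopy K m i j y - z, ?_⟩
    rw [map_sub]
    rw [sub_eq_iff_eq_add] at hz
    rw [hz]
    abel

/-- A boundary in the span of the strings of length at most one bounds in this span. -/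
theorem exists_short_bound {i j : Fin n} {x : Str (CGen n) i j →₀ K} (hx : x ∈ shortStr K i j 2)
    (y : Str (CGen n) i j →₀ K) (hy : cD K m y = x) : ∃ y₀ ∈ shortStr K i j 2, cD K m y₀ = x := by
  obtain ⟨N, hN⟩ := exists_mem_shortStr K y
  induction N generalizing y with
  | zero => exact ⟨y, by simpa using hN, hy⟩
  | succ N ih =>
    have h1 := homotopy_reduce K m (N := 2 + N) (by omega)
      (by rw [add_assoc]; exact_mod_cast hN)
    rw [hy, homotopy_of_mem_shortStr_two K m hx, add_zero] at h1
    have h2 := neg_mem h1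
    rw [neg_sub] at h2
    -- As `h x = 0`, the element `y - ∂hy` is shorter than `y` and still bounds `x`.
    exact ih _ (by rw [map_sub, cD_cD, hy, sub_zero]) h2

/-! ### Identification of `K_n` with the complex of short strings -/

variable [NeZero n]

/-- The linear part of the functor. -/
abbrev linPart (i j : Fin n) : (kontsevich K n m).Hom i j →ₗ[K] (Str (CGen n) i j →₀ K) :=
  Finsupp.linearCombination K fun b => genVal K m (one b) + unitVal K (one b)

theorem linPart_unit (i : Fin n) : genVal K m (one (.e i)) +
    unitVal K (one (.e i) : Str (kontsevich K n m).B i i) =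
      Finsupp.single (nil i : Str (CGen n) i i) 1 := functor_unit K m i

theorem linPart_gen {i j : Fin n} (a : XGen n i j) :
    genVal K m (one (.gen a)) + unitVal K (one (.gen a) : Str (kontsevich K n m).B i j) =
      -cElt K a.wrap i j := by
  have h : (one (.gen a) : Str (kontsevich K n m).B i j).toGen? = some (one a) := rfl
  have h1 : (unitVal K (one (.gen a) : Str (kontsevich K n m).B i j) :
    Str (CGen n) i j →₀ K) = 0 := rfl
  have h2 : (one a).wrap = a.wrap := Nat.zero_add _
  rw [genVal_of_some h, h1, add_zero, h2]

theorem XGen.wrap_valid {i j : Fin n} (a : XGen n i j) : 1 ≤ a.wrap ∨ i < j := by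
  have h := (one a).wrap_valid (Nat.succ_ne_zero 0)
  rwa [show (one a).wrap = a.wrap from Nat.zero_add _] at h

theorem exists_xgen {s : ℕ} {i j : Fin n} (h : (s : ℤ) * n + (j : ℕ) - (i : ℕ) = 1) :
    ∃ a : XGen n i j, a.wrap = s := by
  have h1 := (XGen.x i).wrap_spec
  have h2 := winding_one_cases h
  have h3 := winding_one_cases h1
  have h4 : i + 1 = j := by
    have := (i + 1).2
    have := j.2
    apply Fin.ext
    omega
  subst h4
  exact ⟨.x i, by omega⟩

theorem linPart_mem {i j : Fin n} (a : (kontsevich K n m).Hom i j) :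
    linPart K m i j a ∈ shortStr K i j 2 := by
  induction a using Finsupp.induction_linear with
  | zero => rw [map_zero]; exact zero_mem _
  | add f g hf hg => rw [map_add]; exact add_mem hf hg
  | single b c =>
    rw [Finsupp.linearCombination_single]
    refine Submodule.smul_mem _ _ ?_
    cases b with
    | e =>
      rw [linPart_unit]
      exact single_mem_shortStr K (by simp [totalLen]) 1
    | gen a =>
      have h := linPart_gen K m a
      rw [h, cElt_of_valid K (XGen.wrap_valid a)]
      refine neg_mem (single_mem_shortStr K ?_ 1)
      have := XGen.wrap_spec a
      simp only [one, totalLen, cLen]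
      omega

/-- The short strings are the identities and the generators of length one, which are the images of
the units and, up to sign, of the `x_i`. -/
theorem exists_linPart_eq {i j : Fin n} {y : Str (CGen n) i j →₀ K} (hy : y ∈ shortStr K i j 2) :
    ∃ a, linPart K m i j a = y := by
  change y ∈ LinearMap.range (linPart K m i j)
  refine shortStr_induction K LinearMap.id _ (fun p hp => ?_) hy
  rcases eq_nil_or_one_of_totalLen_lt_two p hp with ⟨rfl, rfl⟩ | ⟨a, ha, rfl⟩
  · refine ⟨Finsupp.single (.e i) 1, ?_⟩
    rw [Finsupp.linearCombination_single, linPart_unit, one_smul]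
    rfl
  · obtain ⟨b, hb⟩ := exists_xgen ha
    refine ⟨-Finsupp.single (.gen b) 1, ?_⟩
    rw [map_neg, Finsupp.linearCombination_single, linPart_gen, one_smul, neg_neg, hb,
      cElt_of_valid K a.2]
    rfl

open Classical in
/-- A left inverse of the linear part of the functor, on strings. -/
def linPartInv {i j : Fin n} : Str (CGen n) i j → (kontsevich K n m).Hom i j
  | .nil _ => Finsupp.single (.e _) 1
  | .cons (.nil _) _ =>
    if h : Nonempty (XGen n _ _) then -Finsupp.single (.gen (Nonempty.some h)) 1 else 0
  | _ => 0

theorem linPart_injective (i j : Fin n) : Function.Injective (linPart K m i j) := by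
  let G : (Str (CGen n) i j →₀ K) →ₗ[K] (kontsevich K n m).Hom i j :=
    Finsupp.linearCombination K (linPartInv K m)
  have hG : G ∘ₗ linPart K m i j = LinearMap.id := by
    refine Finsupp.lhom_ext' fun b => LinearMap.ext_ring ?_
    change G (linPart K m i j (Finsupp.single b 1)) = Finsupp.single b 1
    rw [Finsupp.linearCombination_single, one_smul]
    cases b with
    | e =>
      rw [linPart_unit, Finsupp.linearCombination_single, one_smul]
      rfl
    | gen a =>
      have h := linPart_gen K m a
      rw [h, cElt_of_valid K (XGen.wrap_valid a), map_neg, Finsupp.linearCombination_single,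
        one_smul]
      have h1 : Nonempty (XGen n i j) := ⟨a⟩
      have h2 : h1.some = a := Subsingleton.elim (α := XGen n i j) _ _
      simp only [one, linPartInv, dif_pos h1, neg_neg]
      exact congrArg (fun c : XGen n i j => Finsupp.single (UBasis.gen c) (1 : K)) h2
  exact Function.LeftInverse.injective (g := G) fun a => LinearMap.congr_fun hG a

/-- The linear part of the functor intertwines the differentials, up to sign. -/
theorem cD_linPart_single {i j : Fin n} (b : (kontsevich K n m).B i j) :
    cD K m (linPart K m i j (Finsupp.single b 1)) =
      (-1 : K) ^ (kontsevich K n m).bdeg b • linPart K m i j ((kontsevich K n m).op (one b)) := by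
  have h := functor_eq K m (one b) (by simp [one, len])
  have h1 : prodSum K m (fun t => genVal K m t + unitVal K t)
      (fun u => genVal K m u + unitVal K u) (one b) = 0 := by
    have h0 : ∀ k : Fin n, genVal K m (nil k) +
        unitVal K (nil k : Str (kontsevich K n m).B k k) = 0 := fun k => by
      rw [genVal_of_len_eq_zero _ rfl, unitVal_of_len_ne_one _ (by simp [len]), add_zero]
    simp only [prodSum, one, splits, List.map_cons, List.map_nil, List.sum_cons, List.sum_nil,
      h0, map_zero, LinearMap.zero_apply, smul_zero, add_zero]
  have h2 : insertSum (kontsevich K n m).op (fun w => genVal K m w + unitVal K w) (one b) =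
      linPart K m i j ((kontsevich K n m).op (one b)) := by
    rw [one, insertSum_cons, insertSum_nil, add_zero]
    simp only [splits, List.map_cons, List.map_nil, List.sum_cons, List.sum_nil, add_zero,
      sdeg_nil, zpow_zero, one_smul]
    rfl
  rw [h1, h2, add_zero, sdeg_one, sub_add_cancel] at h
  rw [← h, Finsupp.linearCombination_single, one_smul, smul_smul, neg_one_zpow_mul,
    neg_one_zpow_eq_one (by omega), one_smul]

/-- The sign `(-1)^|a|`. -/
def degSign (i j : Fin n) : (kontsevich K n m).Hom i j →ₗ[K] (kontsevich K n m).Hom i j :=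
  Finsupp.linearCombination K fun b => (-1 : K) ^ (kontsevich K n m).bdeg b • Finsupp.single b 1

/-- The sign comes from `𝔪_1 = (-1)^|a| ∂` on the DG side; `degSign` moves it into the argument so
that `a` need not be homogeneous. -/
theorem cD_linPart {i j : Fin n} (a : (kontsevich K n m).Hom i j) :
    cD K m (linPart K m i j a) =
      linPart K m i j ((kontsevich K n m).m₁ i j (degSign K m i j a)) := by
  induction a using Finsupp.induction_linear with
  | zero => simp only [map_zero]
  | add f g hf hg => simp only [map_add, hf, hg]
  | single b c =>
    have : Finsupp.single b c = c • Finsupp.single b (1 : K) := by simp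
    rw [this]
    simp only [map_smul]
    rw [cD_linPart_single, degSign, Finsupp.linearCombination_single, one_smul, m₁, map_smul,
      map_smul, Finsupp.linearCombination_single, one_smul]

theorem degSign_of_support {i j : Fin n} (d : ℤ) (a : (kontsevich K n m).Hom i j)
    (ha : ∀ b ∈ a.support, (kontsevich K n m).bdeg b = d) :
    degSign K m i j a = (-1 : K) ^ d • a := by
  rw [degSign, Finsupp.linearCombination_apply]
  conv_rhs => rw [← Finsupp.sum_single a, Finsupp.smul_sum]
  refine Finsupp.sum_congr fun b hb => ?_
  rw [ha b hb, smul_comm, Finsupp.smul_single_one]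

/-- As `𝔪_1` has degree one, conjugation by `degSign` changes its sign. Hence the vanishing of `𝔪_1`
on `degSign a` implies that on `a`. -/
theorem m₁_eq_neg {i j : Fin n} (a : (kontsevich K n m).Hom i j) :
    (kontsevich K n m).m₁ i j a =
      -degSign K m i j ((kontsevich K n m).m₁ i j (degSign K m i j a)) := by
  induction a using Finsupp.induction_linear with
  | zero => simp only [map_zero, neg_zero]
  | add f g hf hg => simp only [map_add, neg_add]; rw [← hf, ← hg]
  | single b c =>
    have : Finsupp.single b c = c • Finsupp.single b (1 : K) := by simp
    rw [this]
    simp only [map_smul, ← smul_neg]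
    have h1 : (kontsevich K n m).m₁ i j (Finsupp.single b 1) =
        (kontsevich K n m).op (one b) := by
      rw [m₁, Finsupp.linearCombination_single, one_smul]
    have h2 : degSign K m i j (Finsupp.single b 1) =
        (-1 : K) ^ (kontsevich K n m).bdeg b • Finsupp.single b 1 := by
      rw [degSign, Finsupp.linearCombination_single, one_smul]
    rw [h2, map_smul, map_smul, h1,
      degSign_of_support K m ((kontsevich K n m).bdeg b + 1), smul_smul, neg_one_zpow_mul,
      neg_one_zpow_eq_neg_one (by omega), neg_one_smul, neg_neg]
    intro b' hb'
    rw [(kontsevich_isAInf K m).op_deg _ b' hb']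
    simp only [one, Str.deg, len]
    push_cast
    ring

theorem internalFunctor_isQuasiIso : (internalFunctor K m).IsQuasiIso := by
  intro i j
  constructor
  · rintro a - ⟨y, hy⟩
    obtain ⟨y₀, hy₀, h⟩ := exists_short_bound K m (linPart_mem K m a) y hy.symm
    obtain ⟨a', rfl⟩ := exists_linPart_eq K m hy₀
    rw [cD_linPart] at h
    -- The primitive of `a` is `degSign a'`, where `a'` is the preimage of the short primitive.
    exact ⟨_, (linPart_injective K m i j h).symm⟩
  · intro y hy
    obtain ⟨y₀, hy₀, z, h⟩ := exists_short_cycle K m y hy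
    obtain ⟨a, rfl⟩ := exists_linPart_eq K m hy₀
    refine ⟨a, z, ?_, h⟩
    have h1 : cD K m y = 0 := hy
    rw [h, map_add, cD_cD, add_zero, cD_linPart] at h1
    have h2 := linPart_injective K m i j (h1.trans (map_zero _).symm)
    rw [m₁_eq_neg, h2, map_zero, neg_zero]

end QuasiIso

end AInf

end

theorem mainTheorem4 (K : Type*) [Field K] (n : ℕ) [NeZero n] (m : Fin n → ℤ) :
    (AInf.kontsevich K n m).IsAInf ∧
    (AInf.internalDG K n m).IsDG ∧
    (AInf.cobar (AInf.bar (AInf.kontsevich K n m))).IsDG ∧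
    Nonempty (AInf.DGIso (AInf.internalDG K n m)
      (AInf.cobar (AInf.bar (AInf.kontsevich K n m)))) ∧
    ∃ f : AInf.AInfFunctor (AInf.kontsevich K n m) (AInf.internalDG K n m), f.IsQuasiIso := by
  obtain ⟨φ⟩ := AInf.nonempty_cobarBarIso K m
  have hI := AInf.internalDG_isDG K m
  exact ⟨AInf.kontsevich_isAInf K m, hI, φ.symm.isDG hI, ⟨φ.symm⟩,
    AInf.internalFunctor K m, AInf.internalFunctor_isQuasiIso K m⟩
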